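/- **Setting.** An instance of edge-weighted online stochastic matching consists of a finite set $I$ of online vertex types, a finite set $J$ of offline vertices, a set of edges $E\subseteq I\times J$ with weights $w_{ij}\ge 0$, and arrival rates $\lambda_i\ge 0$ (not assumed integral). In the Poisson arrival model, the online vertices of the types $i\in I$ arrive according to independent Poisson processes of rates $\lambda_i$ on the time interval $[0,1]$. An online algorithm immediately and irrevocably matches each arriving vertex to an unmatched adjacent offline vertex or discards it. $\mathrm{OPT}$ is the maximum weight of a matching between the online vertices that arrived and $J$; an algorithm is $\alpha$-competitive if on every instance the expected total weight of the edges it matches is at least $\alpha\,\mathbf E[\mathrm{OPT}]$. The Jaillet–Lu LP is to maximize $\sum_{(i,j)\in E} w_{ij}x_{ij}$ subject to $x_{ij}\ge 0$, $x_{ij}=0$ for $(i,j)\notin E$, $\sum_j x_{ij}\le\lambda_i$ for all $i$, $\sum_i x_{ij}\le 1$ for all $j$, and $\sum_i (2x_{ij}-\lambda_i)^+\le 1-\ln 2$ for all $j$. *Preprocessing.* A preprocessing of a feasible solution $x$ adds finitely many dummy offline vertices and one dummy online type, and splits every online type into finitely many types: it consists of a finite set of types $u$, each a part of one $i\in I$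 or of the dummy type, with rates $\mu_u\ge 0$ and flows $z_{uv}\ge0$ to the offline vertices $v$ (the elements of $J$ and the dummies), such that the parts $u$ of each $i\in I$ satisfy $\sum_u\mu_u=\lambda_i$ and $\sum_u z_{uj}=x_{ij}$ for $j\in J$, and such that $\sum_v z_{uv}=\mu_u$ for all $u$; $\sum_u z_{uv}=1$ for all $v$; $z_{uv}\in\{0,\mu_u/2,\mu_u\}$; and $\sum_u(2z_{uv}-\mu_u)^+\le 1-\ln2$ for all $v$. All edges at dummy vertices have weight $0$. The neighbors of $u$ are the $v$ with $z_{uv}>0$; $u$ is first-class if it has a neighbor with $z_{uv}=\mu_u$, and second-class otherwise (then it has two neighbors, with flow $\mu_u/2$ each). *Multistage Suggested Matching* with boundary times $0\le t_0\le t_1\le 1$, run on a preprocessing: in addition to the real arrivals, arrivals of the dummy online type are simulated as an independent Poisson process whose rate is the sum of the $\mu_u$ of its parts. The type of every arriving vertex is changed, independently, to a random part $u$ of its type, with probability proportional to $\mu_u$. If $u$ is first-class, the vertex is matched to its only neighbor if that is unmatched. If $u$ is second-class and the arrival time is $t$: for $t\le t_0$ the vertex is discarded; for $t_0<t\le t_1$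 one of the two neighbors is chosen by an independent fair coin, and the vertex is matched to it if it is unmatched; for $t>t_1$, if exactly one of the two neighbors was unmatched at time $t_1$, the vertex is matched to that neighbor if it is still unmatched, and otherwise a neighbor is chosen by a fair coin as before. The objective counts the weights $w_{ij}$ of the matched edges between real online vertices and $J$. **Theorem 2.** Multistage Suggested Matching with $t_0=0.05$ and $t_1=0.75$ is $0.645$-competitive for edge-weighted online stochastic matching in the Poisson arrival model. Precisely, on every instance the Jaillet–Lu LP has an optimal solution; every feasible solution $x$ has a preprocessing; for every feasible $x$ and every preprocessing of it, each edge $(u,v)$ is matched (that is, in the end $v$ is matched to an online vertex of type $u$) with probability at least $0.645\,z_{uv}$; and if $x$ is an optimal solution of the LP, then the expected total weight of the edges that the algorithm matches is at least $0.645\,\mathbf E[\mathrm{OPT}]$. -/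

import Mathlib

open MeasureTheory ProbabilityTheory
open scoped NNReal ENNReal

noncomputable section

namespace OnlineMatching

/-- An instance of edge-weighted online stochastic matching: online vertex types `I`, offline
vertices `J`, the edges, their weights (only the weights of edges matter) and the arrival rates. -/
structure StochInstance (I J : Type*) where
  Adj : I → J → Prop
  weight : I → J → ℝ
  rate : I → ℝ≥0
  weight_nonneg : ∀ i j, Adj i j → 0 ≤ weight i j

/-! ### Poisson arrivals -/

/-- The possible arrivals of one online type: how many there are, and for each of them its arrival
time and a mark in `M`. -/
abbrev Arrivals (M : Type*) : Type _ := Σ n : ℕ, (Fin n → ℝ × M)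

/-- The law of a Poisson process of rate `r` on the time interval `[0,1]` whose points carry
independent marks of law `κ`: the number of points is Poisson with mean `r`, and given this number
the points are independent, each with a uniform time in `[0,1]` and an independent mark. -/
def poissonProcess {M : Type*} [MeasurableSpace M] (r : ℝ≥0) (κ : Measure M) :
    Measure (Arrivals M) :=
  (poissonMeasure r).bind fun n =>
    (Measure.pi fun _ : Fin n => ((volume : Measure ℝ).restrict (Set.Icc 0 1)).prod κ).map
      (Sigma.mk (β := fun n : ℕ => Fin n → ℝ × M) n)

namespace StochInstance

variable {I J : Type*} [Fintype I] [Fintype J] (G : StochInstance I J)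

/-! ### The offline optimum -/

/-- A matching in the bipartite graph between the online vertices that have arrived (`n i` of them
of type `i`) and the offline vertices. -/
def IsMatching (n : I → ℕ) (M : Finset ((Σ i, Fin (n i)) × J)) : Prop :=
  (∀ e ∈ M, G.Adj e.1.1 e.2) ∧
  (∀ e ∈ M, ∀ e' ∈ M, e.1 = e'.1 → e = e') ∧
  (∀ e ∈ M, ∀ e' ∈ M, e.2 = e'.2 → e = e')

/-- The maximum weight of a matching, when `n i` online vertices of type `i` have arrived. -/
def optValue (n : I → ℕ) : ℝ :=
  sSup {W : ℝ | ∃ M, G.IsMatching n M ∧ W = ∑ e ∈ M, G.weight e.1.1 e.2}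

/-- The law of the arrivals: independent Poisson processes on `[0,1]`, of rate `λ_i` for type `i`
(with trivial marks). -/
def arrivalLaw : Measure (I → Arrivals Unit) :=
  Measure.pi fun i => poissonProcess (G.rate i) (Measure.dirac ())

/-- The offline optimum of a realization of the arrivals. -/
def offlineOpt (ω : I → Arrivals Unit) : ℝ := G.optValue fun i => (ω i).1

/-! ### The Jaillet–Lu linear program -/

structure IsFeasible (x : I → J → ℝ) : Prop where
  nonneg : ∀ i j, 0 ≤ x i j
  support : ∀ i j, ¬ G.Adj i j → x i j = 0
  online : ∀ i, ∑ j, x i j ≤ G.rate i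
  offline : ∀ j, ∑ i, x i j ≤ 1
  jailletLu : ∀ j, ∑ i, max (2 * x i j - G.rate i) 0 ≤ 1 - Real.log 2

def objective (x : I → J → ℝ) : ℝ := ∑ i, ∑ j, G.weight i j * x i j

def IsOptimal (x : I → J → ℝ) : Prop :=
  G.IsFeasible x ∧ ∀ x', G.IsFeasible x' → G.objective x' ≤ G.objective x

/-! ### Preprocessed solutions -/

open Classical in
/-- A preprocessing of the fractional matching `x`. It adds `numDummy` dummy offline vertices and
one dummy online type, and splits every online type. The new types are `Fin numTypes`; the type `u`
is a part of the original type `i` if `orig u = some i`, and a part of the dummy online type if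
`orig u = none`. The offline vertices are now `J ⊕ Fin numDummy`. The split preserves the rates
(`split_rate`) and the flows to the original offline vertices (`split_flow`). -/
structure Preprocessed (x : I → J → ℝ) where
  numTypes : ℕ
  numDummy : ℕ
  orig : Fin numTypes → Option I
  rate : Fin numTypes → ℝ≥0
  flow : Fin numTypes → J ⊕ Fin numDummy → ℝ
  flow_nonneg : ∀ u v, 0 ≤ flow u v
  split_rate : ∀ i, ∑ u with orig u = some i, rate u = G.rate i
  split_flow : ∀ i j, ∑ u with orig u = some i, flow u (Sum.inl j) = x i j
  online : ∀ u, ∑ v, flow u v = rate u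
  offline : ∀ v, ∑ u, flow u v = 1
  discrete : ∀ u v, flow u v = 0 ∨ flow u v = rate u / 2 ∨ flow u v = rate u
  jailletLu : ∀ v, ∑ u, max (2 * flow u v - rate u) 0 ≤ 1 - Real.log 2

namespace Preprocessed

variable {G} {x : I → J → ℝ} (P : G.Preprocessed x)

/-- The offline vertices after the preprocessing, dummy ones included. -/
abbrev Offline : Type _ := J ⊕ Fin P.numDummy

/-- The neighbors of the type `u` are the offline vertices to which it has positive flow. -/
def neighbors (u : Fin P.numTypes) : Finset P.Offline := {v | 0 < P.flow u v}

/-- First-class types have an edge with flow equal to the rate; all other types (with positive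
rate) are second-class: they have two neighbors. -/
def FirstClass (u : Fin P.numTypes) : Prop := ∃ v ∈ P.neighbors u, P.flow u v = P.rate u

open Classical in
/-- The rate at which online vertices of the original type `s = some i`, or of the dummy online
type `s = none`, arrive. The arrivals of the dummy type are simulated by the algorithm. -/
def sourceRate : Option I → ℝ≥0
  | some i => G.rate i
  | none => ∑ u with P.orig u = none, P.rate u

/-! ### The random choices of the algorithm -/

/-- The random choices made for one arrival of (original or dummy) type `s`: the part `typ` of `s`
to which the type is changed, and a neighbor `coin` of `typ`. -/
structure Mark (s : Option I) where
  typ : Fin P.numTypes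
  orig_typ : P.orig typ = s
  coin : P.Offline
  coin_mem : coin ∈ P.neighbors typ

instance (s : Option I) : MeasurableSpace (P.Mark s) := ⊤

open Classical in
/-- The type is changed to its part `u` with probability `rate u / sourceRate s`, and then `coin` is
a uniformly random neighbor of `u`, so each of the two neighbors has probability `1/2` if `u` is
second-class. -/
def markLaw (s : Option I) : Measure (P.Mark s) :=
  ∑ u : {u // P.orig u = s}, ∑ v : {v // v ∈ P.neighbors u},
    (P.rate u / P.sourceRate s * ((P.neighbors u).card : ℝ≥0)⁻¹) •
      Measure.dirac (⟨u.1, u.2, v.1, v.2⟩ : P.Mark s)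

/-- The sample space of a run of the algorithm: the arrivals of the original types and of the dummy
type, with the random choices of the algorithm as marks. -/
abbrev Sample : Type _ := (s : Option I) → Arrivals (P.Mark s)

/-- The arrivals of different types are independent Poisson processes on `[0,1]`, and the choices
for different arrivals are independent. -/
def law : Measure P.Sample :=
  Measure.pi fun s => poissonProcess (P.sourceRate s) (P.markLaw s)

variable {P}

/-- The online vertices that have arrived. -/
abbrev Vertex (ω : P.Sample) : Type _ := Σ s : Option I, Fin (ω s).1

def time (ω : P.Sample) (a : Vertex ω) : ℝ := ((ω a.1).2 a.2).1

def mark (ω : P.Sample) (a : Vertex ω) : P.Mark a.1 := ((ω a.1).2 a.2).2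

/-- The online vertices in order of their arrival. -/
def arrivalOrder (ω : P.Sample) : List (Vertex ω) :=
  (Finset.univ : Finset (Vertex ω)).toList.mergeSort fun a b => decide (time ω a ≤ time ω b)

/-! ### The algorithm Multistage Suggested Matching

Its state is the function that maps each offline vertex to the online vertex to which it has been
matched, or to `none` if it is unmatched. -/

open Classical in
/-- If the offline vertex `target` is unmatched, match it to the online vertex `a`. -/
def tryMatch {ω : P.Sample} (m : P.Offline → Option (Vertex ω)) (a : Vertex ω) :
    Option P.Offline → P.Offline → Option (Vertex ω)
  | none => m
  | some v => if m v = none then Function.update m v (some a) else m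

open Classical in
/-- The offline vertex to which an online vertex arriving at time at most `t₁` is to be matched. For
a first-class type `coin` is the only neighbor. -/
def earlyTarget (t₀ : ℝ) (ω : P.Sample) (a : Vertex ω) : Option P.Offline :=
  if P.FirstClass (mark ω a).typ then some (mark ω a).coin
  else if time ω a ≤ t₀ then none
  else some (mark ω a).coin

open Classical in
/-- The offline vertex to which an online vertex arriving after time `t₁` is to be matched, where
`m₁` is the state at time `t₁`: if a second-class type had exactly one neighbor that was unmatched
at time `t₁`, it is this neighbor. -/
def lateTarget {ω : P.Sample} (m₁ : P.Offline → Option (Vertex ω)) (a : Vertex ω) :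
    Option P.Offline :=
  if P.FirstClass (mark ω a).typ then some (mark ω a).coin
  else if h : ∃ v, {v' ∈ P.neighbors (mark ω a).typ | m₁ v' = none} = {v} then some h.choose
  else some (mark ω a).coin

open Classical in
/-- The state at time `t₁`. -/
def stateAt (t₀ t₁ : ℝ) (ω : P.Sample) : P.Offline → Option (Vertex ω) :=
  ((arrivalOrder ω).filter fun a => decide (time ω a ≤ t₁)).foldl
    (fun m a => tryMatch m a (earlyTarget t₀ ω a)) fun _ => none

open Classical in
/-- The final state: the matching that the algorithm produces. -/
def output (t₀ t₁ : ℝ) (ω : P.Sample) : P.Offline → Option (Vertex ω) :=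
  ((arrivalOrder ω).filter fun a => decide (t₁ < time ω a)).foldl
    (fun m a => tryMatch m a (lateTarget (stateAt t₀ t₁ ω) a)) (stateAt t₀ t₁ ω)

/-- The edge from the (split) type `u` to the offline vertex `v` is matched in the end. -/
def EdgeMatched (t₀ t₁ : ℝ) (u : Fin P.numTypes) (v : P.Offline) (ω : P.Sample) : Prop :=
  ∃ a : Vertex ω, output t₀ t₁ ω v = some a ∧ (mark ω a).typ = u

/-- The contribution of an offline vertex to the objective, where `m` is the online vertex to which
it is matched. Edges at dummy vertices have weight `0`. -/
def gain {ω : P.Sample} (j : J) (m : Option (Vertex ω)) : ℝ :=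
  match m with
  | some ⟨some i, _⟩ => G.weight i j
  | _ => 0

/-- The total weight of the edges of the original graph that the algorithm matches. -/
def algValue (t₀ t₁ : ℝ) (ω : P.Sample) : ℝ :=
  ∑ j : J, gain j (output t₀ t₁ ω (Sum.inl j))

end Preprocessed

end StochInstance

end OnlineMatching

end

/-!
The algorithm keeps at least `0.645` of the flow of every edge, and the linear program bounds the
expected offline optimum; weighting the edges gives the competitive ratio.

**The linear program.** Let `x i j` be the expected number of edges between `i` and `j` in an optimal
matching of the arrived vertices. For a set `S` of types, `j` is matched to a type in `S` only if
one of them arrives, so `∑ i ∈ S, x i j ≤ 1 - exp (-λ(S))`. If `S` consists of the types with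
`2 x i j > λ i`, then `∑ i, (2 x i j - λ i)⁺ ≤ 2 (1 - exp (-λ(S))) - λ(S) ≤ 1 - log 2`, so `x` is
feasible (`isFeasible_optFlow`).

**Preprocessing.** After dummies have been added, the flow of a type of rate `λ` is laid out on
the interval `[0, λ]`, which is folded in the middle; the points that come to lie on each other are
the pairs of neighbors (`exists_pairing`, `nonempty_preprocessed`).

**Matching probabilities.** The arrivals with split type `u` and coin `c` form independent Poisson
processes of rate `flow u c`. An arrival at time `τ` that aims at `v` is matched to `v` if no
earlier arrival can have been matched to `v`, that is, if all other arrivals avoid a set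
`blockers v τ` that does not depend on the run: up to `t₁` the arrivals that aim at `v`, later all
arrivals of types with neighbor `v`. If `y` is the first-class flow to `v`, the intensity of this
set is at most `y τ + (1 - y) ((τ - t₀)⁺ + (τ - t₁)⁺)` (`intensity_blockers_le`). By Mecke's
formula (`lintegral_sum_erase_poissonProcesses`), an arrival sees the other arrivals as a fresh
sample, so the edge `(u, v)` is matched with probability at least `flow u v` times the integral
over `τ` of the probability that the blockers are avoided. A second-class arrival after `t₁` whose
coin is its other neighbor `w` also succeeds if `w` was matched by the time `t₁`, for which it
suffices that some arrival claims `w` between `t₀` and `t₁`; these claims are independent of the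
blockers of `v`.

**Numbers.** It remains to bound two explicit integrals for `0 ≤ y ≤ 1 - log 2`, which is the range
that the Jaillet–Lu constraint allows (`bound_of_firstClass`, `bound_of_not_firstClass`).
-/

noncomputable section

namespace OnlineMatching

set_option linter.unusedSectionVars false

/-! ### Measurability on disjoint unions and on products of them -/

section Sigma

variable {α : Type*} {β : α → Type*} [∀ a, MeasurableSpace (β a)]

theorem measurableSet_sigma_iff {s : Set (Sigma β)} :
    MeasurableSet s ↔ ∀ a, MeasurableSet (Sigma.mk a ⁻¹' s) := by
  rw [Sigma.instMeasurableSpace, MeasurableSpace.measurableSet_iInf]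
  rfl

theorem measurable_sigma_iff {γ : Type*} [MeasurableSpace γ] {f : Sigma β → γ} :
    Measurable f ↔ ∀ a, Measurable fun b => f ⟨a, b⟩ := by
  constructor
  · intro h a s hs
    exact measurableSet_sigma_iff.1 (h hs) a
  · intro h s hs
    exact measurableSet_sigma_iff.2 fun a => h a hs

theorem measurable_sigmaMk (a : α) : Measurable (Sigma.mk (β := β) a) :=
  fun _ hs => measurableSet_sigma_iff.1 hs a

theorem measurable_sigma_fst [MeasurableSpace α] : Measurable (Sigma.fst : Sigma β → α) :=
  measurable_sigma_iff.2 fun _ => measurable_const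

theorem measurableEmbedding_sigmaMk (a : α) : MeasurableEmbedding (Sigma.mk (β := β) a) where
  injective := sigma_mk_injective
  measurable := measurable_sigmaMk a
  measurableSet_image' := by
    intro s hs
    refine measurableSet_sigma_iff.2 fun b => ?_
    by_cases h : b = a
    · subst h
      rwa [Set.preimage_image_eq _ sigma_mk_injective]
    · convert MeasurableSet.empty
      ext x
      simp only [Set.mem_preimage, Set.mem_image, Set.mem_empty_iff_false, iff_false]
      rintro ⟨y, _, hy⟩
      exact h (congrArg Sigma.fst hy).symm

/-- A function on the union of the ranges of countably many measurable embeddings is measurable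
as soon as its compositions with the embeddings are. -/
theorem measurable_of_embedding_cover {ι X Z : Type*} {Y : ι → Type*} [Countable ι]
    [MeasurableSpace X] [MeasurableSpace Z] [∀ i, MeasurableSpace (Y i)] {e : ∀ i, Y i → X}
    (he : ∀ i, MeasurableEmbedding (e i)) (hcover : ∀ x, ∃ i y, e i y = x) {f : X → Z}
    (hf : ∀ i, Measurable fun y => f (e i y)) : Measurable f := by
  intro s hs
  have : f ⁻¹' s = ⋃ i, e i '' ((fun y => f (e i y)) ⁻¹' s) := by
    ext x
    simp only [Set.mem_preimage, Set.mem_iUnion, Set.mem_image]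
    constructor
    · intro hx
      obtain ⟨i, y, rfl⟩ := hcover x
      exact ⟨i, y, hx, rfl⟩
    · rintro ⟨i, y, hy, rfl⟩
      exact hy
  rw [this]
  exact MeasurableSet.iUnion fun i => (he i).measurableSet_image.2 (hf i hs)

theorem measurable_prod_sigma [Countable α] {X Z : Type*} [MeasurableSpace X] [MeasurableSpace Z]
    {f : X × Sigma β → Z} (hf : ∀ a, Measurable fun p : X × β a => f (p.1, ⟨a, p.2⟩)) :
    Measurable f := by
  refine measurable_of_embedding_cover (Y := fun a => X × β a)
    (e := fun a => Prod.map id (Sigma.mk a))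
    (fun a => MeasurableEmbedding.prodMap .id (measurableEmbedding_sigmaMk a)) ?_ hf
  rintro ⟨x, a, b⟩
  exact ⟨a, (x, b), rfl⟩

theorem _root_.MeasurableEmbedding.piMap {ι : Type*} [Countable ι] {X Y : ι → Type*}
    [∀ i, MeasurableSpace (X i)] [∀ i, MeasurableSpace (Y i)] {e : ∀ i, X i → Y i}
    (he : ∀ i, MeasurableEmbedding (e i)) :
    MeasurableEmbedding (fun (x : ∀ i, X i) i => e i (x i)) := by
  rw [MeasurableEmbedding.iff_comap_eq]
  refine ⟨fun x y h => funext fun i => (he i).injective (congrFun h i), ?_, ?_⟩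
  · simp only [MeasurableSpace.pi, MeasurableSpace.comap_iSup, MeasurableSpace.comap_comp]
    refine iSup_congr fun i => ?_
    conv_rhs => rw [← (he i).comap_eq, MeasurableSpace.comap_comp]
    rfl
  · have : Set.range (fun (x : ∀ i, X i) i => e i (x i)) =
        Set.univ.pi fun i => Set.range (e i) := by
      ext y
      simp only [Set.mem_range, Set.mem_univ_pi]
      constructor
      · rintro ⟨x, rfl⟩ i
        exact ⟨x i, rfl⟩
      · intro h
        choose x hx using h
        exact ⟨x, funext hx⟩
    rw [this]
    exact MeasurableSet.univ_pi fun i => (he i).measurableSet_range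

theorem measurable_pi_sigma {ι : Type*} [Finite ι] [Countable α] {Z : Type*} [MeasurableSpace Z]
    {γ : ι → α → Type*} [∀ i a, MeasurableSpace (γ i a)] {f : (∀ i, Sigma (γ i)) → Z}
    (hf : ∀ n : ι → α, Measurable fun y : ∀ i, γ i (n i) => f fun i => ⟨n i, y i⟩) :
    Measurable f := by
  refine measurable_of_embedding_cover (Y := fun n : ι → α => ∀ i, γ i (n i))
    (e := fun n y i => ⟨n i, y i⟩)
    (fun n => MeasurableEmbedding.piMap fun i => measurableEmbedding_sigmaMk (n i)) ?_ hf
  intro x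
  exact ⟨fun i => (x i).1, fun i => (x i).2, rfl⟩

end Sigma

/-! ### Poisson processes -/

section Poisson

variable {M : Type*} [MeasurableSpace M]

/-- The law of the time and the mark of one point of a Poisson process. -/
def pointLaw (κ : Measure M) : Measure (ℝ × M) :=
  ((volume : Measure ℝ).restrict (Set.Icc 0 1)).prod κ

instance (κ : Measure M) [IsFiniteMeasure κ] : IsFiniteMeasure (pointLaw κ) := by
  unfold pointLaw; infer_instance

theorem pointLaw_univ (κ : Measure M) [SFinite κ] : pointLaw κ Set.univ = κ Set.univ := by
  rw [pointLaw, ← Set.univ_prod_univ, Measure.prod_prod]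
  simp

/-- The probability that a Poisson process of rate `r` has `n` points. -/
def poissonWeight (r : ℝ≥0) (n : ℕ) : ℝ≥0∞ := poissonMeasure r {n}

theorem poissonWeight_succ (r : ℝ≥0) (n : ℕ) :
    poissonWeight r (n + 1) * (n + 1 : ℕ) = r * poissonWeight r n := by
  simp only [poissonWeight, poissonMeasure_singleton]
  rw [← ENNReal.ofReal_natCast (n + 1),
    ← ENNReal.ofReal_coe_nnreal, ← ENNReal.ofReal_mul (by positivity),
    ← ENNReal.ofReal_mul (by positivity)]
  congr 1
  rw [Nat.factorial_succ]
  push_cast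
  field_simp
  ring

theorem tsum_poissonWeight_mul_pow (r : ℝ≥0) (q : ℝ≥0) :
    ∑' n, poissonWeight r n * (q : ℝ≥0∞) ^ n = ENNReal.ofReal (Real.exp (r * q - r)) := by
  have h : HasSum (fun n : ℕ => Real.exp (-r) * ((r * q : ℝ) ^ n / n.factorial))
      (Real.exp (-r) * Real.exp (r * q)) := by
    refine HasSum.mul_left _ ?_
    rw [Real.exp_eq_exp_ℝ]
    exact NormedSpace.expSeries_div_hasSum_exp _
  rw [sub_eq_neg_add, Real.exp_add, ← h.tsum_eq,
    ENNReal.ofReal_tsum_of_nonneg (fun n => by positivity) h.summable]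
  congr 1
  ext n
  rw [poissonWeight, poissonMeasure_singleton,
    show (q : ℝ≥0∞) ^ n = ENNReal.ofReal ((q : ℝ) ^ n) by
      rw [ENNReal.ofReal_pow (by positivity), ENNReal.ofReal_coe_nnreal],
    ← ENNReal.ofReal_mul (by positivity)]
  congr 1
  rw [mul_pow]
  ring

theorem lintegral_poissonProcess (r : ℝ≥0) (κ : Measure M) {F : Arrivals M → ℝ≥0∞}
    (hF : Measurable F) :
    ∫⁻ η, F η ∂(poissonProcess r κ) =
      ∑' n, poissonWeight r n *
        ∫⁻ y, F ⟨n, y⟩ ∂Measure.pi fun _ : Fin n => pointLaw κ := by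
  rw [poissonProcess, Measure.lintegral_bind (measurable_of_countable _).aemeasurable
    hF.aemeasurable, lintegral_countable']
  congr 1
  ext n
  rw [mul_comm, poissonWeight, lintegral_map hF (measurable_sigmaMk n)]
  rfl

/-- The arrivals that are left when the `k`-th one is removed. -/
def Arrivals.erase {M : Type*} : (η : Arrivals M) → Fin η.1 → Arrivals M
  | ⟨0, y⟩, _ => ⟨0, y⟩
  | ⟨n + 1, y⟩, k => ⟨n, fun l => y (k.succAbove l)⟩

theorem Arrivals.exists_erase_of_ne (η : Arrivals M) {k l : Fin η.1} (h : l ≠ k) :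
    ∃ l', (η.erase k).2 l' = η.2 l := by
  obtain ⟨_ | n, y⟩ := η
  · exact k.elim0
  · obtain ⟨l', hl'⟩ := Fin.exists_succAbove_eq h
    exact ⟨l', congrArg y hl'⟩

theorem Arrivals.exists_of_erase (η : Arrivals M) (k : Fin η.1)
    (l' : Fin (η.erase k).1) : ∃ l, η.2 l = (η.erase k).2 l' := by
  obtain ⟨_ | n, y⟩ := η
  · exact k.elim0
  · exact ⟨k.succAbove l', rfl⟩

theorem measurable_sum_erase {F : (ℝ × M) × Arrivals M → ℝ≥0∞} (hF : Measurable F) :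
    Measurable fun η : Arrivals M => ∑ k : Fin η.1, F (η.2 k, η.erase k) := by
  refine measurable_sigma_iff.2 fun n => ?_
  cases n with
  | zero => simp
  | succ n =>
    have h : ∀ k : Fin (n + 1), Measurable fun y : Fin (n + 1) → ℝ × M =>
        F (y k, ⟨n, fun l => y (k.succAbove l)⟩) := fun k =>
      hF.comp ((measurable_pi_apply k).prodMk ((measurable_sigmaMk n).comp
        (measurable_pi_lambda _ fun l => measurable_pi_apply _)))
    have hs := Finset.measurable_sum Finset.univ fun k _ => h k
    exact hs

/-- Mecke's formula: the expected sum, over the points of a Poisson process, of a function of the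
point and of the other points. -/
theorem lintegral_sum_erase_poissonProcess (r : ℝ≥0) (κ : Measure M) [IsFiniteMeasure κ]
    {F : (ℝ × M) × Arrivals M → ℝ≥0∞} (hF : Measurable F) :
    ∫⁻ η, ∑ k : Fin η.1, F (η.2 k, η.erase k) ∂(poissonProcess r κ) =
      r * ∫⁻ p, ∫⁻ η, F (p, η) ∂(poissonProcess r κ) ∂pointLaw κ := by
  have hmeas : ∀ n, Measurable fun q : (ℝ × M) × (Fin n → ℝ × M) => F (q.1, ⟨n, q.2⟩) := fun n =>
    hF.comp (measurable_fst.prodMk ((measurable_sigmaMk n).comp measurable_snd))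
  have hpoint : ∀ n (k : Fin (n + 1)),
      ∫⁻ y, F (y k, ⟨n, fun l => y (k.succAbove l)⟩)
        ∂(Measure.pi fun _ : Fin (n + 1) => pointLaw κ) =
      ∫⁻ p, ∫⁻ y, F (p, ⟨n, y⟩) ∂(Measure.pi fun _ : Fin n => pointLaw κ) ∂pointLaw κ := by
    intro n k
    rw [← lintegral_prod _ (hmeas n).aemeasurable,
      ← (measurePreserving_piFinSuccAbove (fun _ : Fin (n + 1) => pointLaw κ) k).lintegral_comp
        (hmeas n)]
    rfl
  rw [lintegral_poissonProcess r κ (measurable_sum_erase hF),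
    tsum_eq_zero_add' ENNReal.summable]
  simp only [Finset.univ_eq_empty, Finset.sum_empty, lintegral_const, zero_mul, mul_zero, zero_add]
  have hin : ∀ p, ∫⁻ η, F (p, η) ∂(poissonProcess r κ) = ∑' n, poissonWeight r n *
      ∫⁻ y, F (p, ⟨n, y⟩) ∂Measure.pi fun _ : Fin n => pointLaw κ := fun p =>
    lintegral_poissonProcess r κ (hF.comp measurable_prodMk_left)
  simp_rw [hin]
  rw [lintegral_tsum fun n =>
    ((hmeas n).lintegral_prod_right'.const_mul _).aemeasurable, ← ENNReal.tsum_mul_left]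
  congr 1
  ext n
  rw [lintegral_const_mul _ (hmeas n).lintegral_prod_right', ← mul_assoc, ← poissonWeight_succ]
  have hsum : ∫⁻ y, ∑ k : Fin (n + 1), F (y k, Arrivals.erase ⟨n + 1, y⟩ k)
      ∂(Measure.pi fun _ : Fin (n + 1) => pointLaw κ) = ∑ k : Fin (n + 1),
        ∫⁻ y, F (y k, ⟨n, fun l => y (k.succAbove l)⟩)
          ∂(Measure.pi fun _ : Fin (n + 1) => pointLaw κ) := by
    have h : ∀ k : Fin (n + 1), Measurable fun y : Fin (n + 1) → ℝ × M =>
        F (y k, ⟨n, fun l => y (k.succAbove l)⟩) := fun k =>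
      hF.comp ((measurable_pi_apply k).prodMk ((measurable_sigmaMk n).comp
        (measurable_pi_lambda _ fun l => measurable_pi_apply _)))
    exact lintegral_finsetSum _ fun k _ => h k
  refine (congrArg _ hsum).trans ?_
  simp_rw [hpoint]
  rw [Finset.sum_const, Finset.card_univ, Fintype.card_fin, nsmul_eq_mul, mul_assoc]

/-- No point of `η` lies in `A`. -/
def Arrivals.Avoids {M : Type*} (η : Arrivals M) (A : Set (ℝ × M)) : Prop := ∀ k, η.2 k ∉ A

theorem measurableSet_avoids {A : Set (ℝ × M)} (hA : MeasurableSet A) :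
    MeasurableSet {η : Arrivals M | η.Avoids A} := by
  refine measurableSet_sigma_iff.2 fun n => ?_
  have : Sigma.mk n ⁻¹' {η : Arrivals M | η.Avoids A} =
      ⋂ k : Fin n, (fun y : Fin n → ℝ × M => y k) ⁻¹' Aᶜ := by
    ext y; simp [Arrivals.Avoids]
  rw [this]
  exact MeasurableSet.iInter fun k => measurable_pi_apply k hA.compl

/-- The hypothesis `hr` says that the marks have a probability law, unless the rate is `0`. -/
theorem poissonProcess_avoids {r : ℝ≥0} {κ : Measure M} [IsFiniteMeasure κ]
    (hr : r * κ Set.univ = r) {A : Set (ℝ × M)} (hA : MeasurableSet A) :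
    poissonProcess r κ {η | η.Avoids A} =
      ENNReal.ofReal (Real.exp (-(r * (pointLaw κ).real A))) := by
  rw [← lintegral_indicator_one (measurableSet_avoids hA), lintegral_poissonProcess r κ
    (measurable_one.indicator (measurableSet_avoids hA))]
  have hn : ∀ n, ∫⁻ y, {η : Arrivals M | η.Avoids A}.indicator 1 ⟨n, y⟩
      ∂(Measure.pi fun _ : Fin n => pointLaw κ) = pointLaw κ Aᶜ ^ n := by
    intro n
    have : (fun y : Fin n → ℝ × M =>
        {η : Arrivals M | η.Avoids A}.indicator (1 : Arrivals M → ℝ≥0∞) ⟨n, y⟩) =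
        (Set.univ.pi fun _ => Aᶜ).indicator 1 := by
      ext y
      by_cases h : ∀ k, y k ∉ A
      · rw [Set.indicator_of_mem (Set.mem_univ_pi.2 h), Set.indicator_of_mem (by exact h)]
        rfl
      · rw [Set.indicator_of_notMem (by exact h),
          Set.indicator_of_notMem (by rwa [Set.mem_univ_pi])]
    rw [this, lintegral_indicator_one (MeasurableSet.univ_pi fun _ => hA.compl), Measure.pi_pi]
    simp
  simp_rw [hn]
  rw [← ENNReal.coe_toNNReal (measure_ne_top (pointLaw κ) Aᶜ), tsum_poissonWeight_mul_pow]
  congr 2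
  change (r : ℝ) * (pointLaw κ).real Aᶜ - r = _
  rw [measureReal_compl hA, mul_sub]
  have : (r : ℝ) * (pointLaw κ).real Set.univ = r := by
    have := congrArg ENNReal.toReal hr
    rwa [ENNReal.toReal_mul, ← pointLaw_univ κ] at this
  rw [this]
  ring

theorem isProbabilityMeasure_poissonProcess {r : ℝ≥0} {κ : Measure M} [IsFiniteMeasure κ]
    (hr : r * κ Set.univ = r) : IsProbabilityMeasure (poissonProcess r κ) := by
  constructor
  have := poissonProcess_avoids hr MeasurableSet.empty
  simpa [Arrivals.Avoids] using this

/-- Independent Poisson processes on `[0,1]`, with marks that may be of different types. -/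
def poissonProcesses {S : Type*} [Fintype S] {M : S → Type*} [∀ s, MeasurableSpace (M s)]
    (r : S → ℝ≥0) (κ : ∀ s, Measure (M s)) : Measure (∀ s, Arrivals (M s)) :=
  Measure.pi fun s => poissonProcess (r s) (κ s)

section Product

variable {S : Type*} [Fintype S] {M : S → Type*} [∀ s, MeasurableSpace (M s)]
  {r : S → ℝ≥0} {κ : ∀ s, Measure (M s)} [∀ s, IsFiniteMeasure (κ s)]

theorem isProbabilityMeasure_poissonProcesses (hr : ∀ s, r s * κ s Set.univ = r s) :
    IsProbabilityMeasure (poissonProcesses r κ) := by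
  have := fun s => isProbabilityMeasure_poissonProcess (hr s)
  unfold poissonProcesses
  infer_instance

/-- The points of the different processes avoid given sets independently. -/
theorem poissonProcesses_avoids (hr : ∀ s, r s * κ s Set.univ = r s)
    {A : ∀ s, Set (ℝ × M s)} (hA : ∀ s, MeasurableSet (A s)) :
    poissonProcesses r κ {ω | ∀ s, (ω s).Avoids (A s)} =
      ENNReal.ofReal (Real.exp (-∑ s, r s * (pointLaw (κ s)).real (A s))) := by
  have := fun s => isProbabilityMeasure_poissonProcess (hr s)
  have heq : {ω : ∀ s, Arrivals (M s) | ∀ s, (ω s).Avoids (A s)} =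
      Set.univ.pi fun s => {η | η.Avoids (A s)} := by
    ext ω; simp
  rw [heq, poissonProcesses, Measure.pi_pi]
  simp_rw [fun s => poissonProcess_avoids (hr s) (hA s)]
  rw [← ENNReal.ofReal_prod_of_nonneg fun s _ => (Real.exp_pos _).le, ← Real.exp_sum,
    Finset.sum_neg_distrib]

/-- In an integral over a product of probability spaces one may resample one coordinate. -/
theorem lintegral_pi_eq_lintegral_update {ι : Type*} [Fintype ι] [DecidableEq ι] {X : ι → Type*}
    [∀ i, MeasurableSpace (X i)] (μ : ∀ i, Measure (X i)) [∀ i, IsProbabilityMeasure (μ i)]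
    (i : ι) {f : (∀ i, X i) → ℝ≥0∞} (hf : Measurable f) :
    ∫⁻ x, f x ∂Measure.pi μ = ∫⁻ x, ∫⁻ y, f (Function.update x i y) ∂μ i ∂Measure.pi μ := by
  have hsing : (fun x => ∫⁻ y, f (Function.update x i y) ∂μ i) = ∫⋯∫⁻_{i}, f ∂μ := by
    ext x
    rw [lmarginal_singleton]
  rw [hsing]
  refine lintegral_eq_of_lmarginal_eq {i} hf (hf.lmarginal μ) ?_
  ext x
  conv_rhs => rw [lmarginal_singleton]
  simp_rw [lmarginal_update_of_mem μ (Finset.mem_singleton_self i)]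
  simp

/-- Mecke's formula for independent Poisson processes. -/
theorem lintegral_sum_erase_poissonProcesses [DecidableEq S]
    (hr : ∀ s, r s * κ s Set.univ = r s) (s : S)
    {F : (ℝ × M s) × (∀ s, Arrivals (M s)) → ℝ≥0∞} (hF : Measurable F) :
    ∫⁻ ω, ∑ k : Fin (ω s).1, F ((ω s).2 k, Function.update ω s ((ω s).erase k))
        ∂poissonProcesses r κ =
      r s * ∫⁻ p, ∫⁻ ω, F (p, ω) ∂poissonProcesses r κ ∂pointLaw (κ s) := by
  have hprob := fun s => isProbabilityMeasure_poissonProcess (hr s)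
  have hprob' := isProbabilityMeasure_poissonProcesses hr
  have hup : Measurable fun q : (∀ s, Arrivals (M s)) × Arrivals (M s) =>
      Function.update q.1 s q.2 := measurable_update'
  have hF' : Measurable fun q : ((∀ s, Arrivals (M s)) × (ℝ × M s)) × Arrivals (M s) =>
      F (q.1.2, Function.update q.1.1 s q.2) :=
    hF.comp ((measurable_snd.comp measurable_fst).prodMk
      (hup.comp ((measurable_fst.comp measurable_fst).prodMk measurable_snd)))
  let f : (∀ s, Arrivals (M s)) × Arrivals (M s) → ℝ≥0∞ := fun q =>
    ∑ k : Fin q.2.1, F (q.2.2 k, Function.update q.1 s (q.2.erase k))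
  have hf : Measurable f := by
    refine measurable_prod_sigma fun n => ?_
    cases n with
    | zero => simp [f]
    | succ n =>
      have h : ∀ k : Fin (n + 1),
          Measurable fun p : (∀ s, Arrivals (M s)) × (Fin (n + 1) → ℝ × M s) =>
            F (p.2 k, Function.update p.1 s ⟨n, fun l => p.2 (k.succAbove l)⟩) := fun k =>
        hF.comp (((measurable_pi_apply k).comp measurable_snd).prodMk
          (hup.comp (measurable_fst.prodMk ((measurable_sigmaMk n).comp
            (measurable_pi_lambda _ fun l => (measurable_pi_apply _).comp measurable_snd)))))
      have hs := Finset.measurable_sum Finset.univ fun k _ => h k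
      exact hs
  have hf' : Measurable fun ω : ∀ s, Arrivals (M s) => f (ω, ω s) :=
    hf.comp (measurable_id.prodMk (measurable_pi_apply s))
  unfold poissonProcesses at hprob' ⊢
  change ∫⁻ ω, f (ω, ω s) ∂_ = _
  rw [lintegral_pi_eq_lintegral_update _ s hf']
  simp only [Function.update_self]
  have hmecke : ∀ ω : ∀ s, Arrivals (M s),
      ∫⁻ η, ∑ k : Fin η.1, F (η.2 k, Function.update ω s (η.erase k))
        ∂(poissonProcess (r s) (κ s)) =
      r s * ∫⁻ p, ∫⁻ η, F (p, Function.update ω s η) ∂(poissonProcess (r s) (κ s))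
        ∂pointLaw (κ s) := by
    intro ω
    refine lintegral_sum_erase_poissonProcess (r s) (κ s)
      (F := fun q => F (q.1, Function.update ω s q.2)) (hF.comp (measurable_fst.prodMk ?_))
    exact hup.comp (measurable_const.prodMk measurable_snd)
  have hres : ∀ ω : ∀ s, Arrivals (M s), ∀ η, f (Function.update ω s η, η) =
      ∑ k : Fin η.1, F (η.2 k, Function.update ω s (η.erase k)) := fun ω η => by
    simp only [f, Function.update_idem]
  simp_rw [hres, hmecke]
  have hin := hF'.lintegral_prod_right' (ν := poissonProcess (r s) (κ s))
  rw [lintegral_const_mul _ hin.lintegral_prod_right', lintegral_lintegral_swap hin.aemeasurable]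
  congr 1
  refine lintegral_congr fun p => ?_
  exact (lintegral_pi_eq_lintegral_update _ s (hF.comp measurable_prodMk_left)).symm

theorem measurableSet_forall_avoids {X : Type*} [MeasurableSpace X]
    {A : ∀ s, Set (X × (ℝ × M s))} (hA : ∀ s, MeasurableSet (A s)) :
    MeasurableSet {q : X × (∀ s, Arrivals (M s)) |
      ∀ s, (q.2 s).Avoids {p | (q.1, p) ∈ A s}} := by
  have h : ∀ s, MeasurableSet {q : X × Arrivals (M s) | q.2.Avoids {p | (q.1, p) ∈ A s}} := by
    intro s
    classical
    have : Measurable fun q : X × Arrivals (M s) => q.2.Avoids {p | (q.1, p) ∈ A s} := by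
      refine measurable_prod_sigma fun n => ?_
      refine measurable_to_prop ?_
      have heq : (fun q : X × (Fin n → ℝ × M s) =>
          Arrivals.Avoids ⟨n, q.2⟩ {p | (q.1, p) ∈ A s}) ⁻¹' {True} =
          ⋂ k : Fin n, (fun q : X × (Fin n → ℝ × M s) => (q.1, q.2 k)) ⁻¹' (A s)ᶜ := by
        ext q; simp [Arrivals.Avoids]
      rw [heq]
      exact MeasurableSet.iInter fun k => (measurable_fst.prodMk
        ((measurable_pi_apply k).comp measurable_snd)) (hA s).compl
    exact measurableSet_setOfPred.2 this
  simp only [Set.ofPred_forall]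
  refine MeasurableSet.iInter fun s => ?_
  have h' : Measurable fun q : X × (∀ s, Arrivals (M s)) => (q.1, q.2 s) :=
    measurable_fst.prodMk ((measurable_pi_apply s).comp measurable_snd)
  exact h' (h s)

end Product

end Poisson

namespace StochInstance

variable {I J : Type*} [Fintype I] [Fintype J] (G : StochInstance I J)

/-! ### The linear program and the offline optimum -/

theorem isFeasible_zero : G.IsFeasible 0 where
  nonneg _ _ := le_rfl
  support _ _ _ := rfl
  online i := by simp
  offline j := by simp
  jailletLu j := by
    have : ∀ i, max (2 * (0 : I → J → ℝ) i j - G.rate i) 0 = 0 := fun i => by simp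
    simp_rw [this]
    simp only [Finset.sum_const_zero]
    have := Real.log_two_lt_d9
    linarith

theorem isCompact_isFeasible : IsCompact {x : I → J → ℝ | G.IsFeasible x} := by
  have hK : IsCompact (Set.univ.pi fun _ : I => Set.univ.pi fun _ : J => Set.Icc (0 : ℝ) 1) :=
    isCompact_univ_pi fun _ => isCompact_univ_pi fun _ => isCompact_Icc
  refine hK.of_isClosed_subset ?_ ?_
  · have h : {x : I → J → ℝ | G.IsFeasible x} =
        {x : I → J → ℝ | (∀ i j, 0 ≤ x i j) ∧ (∀ i j, ¬ G.Adj i j → x i j = 0) ∧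
          (∀ i, ∑ j, x i j ≤ (G.rate i : ℝ)) ∧ (∀ j, ∑ i, x i j ≤ 1) ∧
          ∀ j, ∑ i, max (2 * x i j - (G.rate i : ℝ)) 0 ≤ 1 - Real.log 2} :=
      Set.ext fun x => ⟨fun h => ⟨h.1, h.2, h.3, h.4, h.5⟩,
        fun ⟨h1, h2, h3, h4, h5⟩ => ⟨h1, h2, h3, h4, h5⟩⟩
    rw [h]
    refine IsClosed.and ?_ (IsClosed.and ?_ (IsClosed.and ?_ (IsClosed.and ?_ ?_)))
    · simp only [Set.ofPred_forall]
      exact isClosed_iInter fun i => isClosed_iInter fun j =>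
        isClosed_le continuous_const (by fun_prop)
    · simp only [Set.ofPred_forall]
      exact isClosed_iInter fun i => isClosed_iInter fun j => isClosed_iInter fun _ =>
        isClosed_eq (by fun_prop) continuous_const
    · simp only [Set.ofPred_forall]
      exact isClosed_iInter fun i => isClosed_le (by fun_prop) continuous_const
    · simp only [Set.ofPred_forall]
      exact isClosed_iInter fun j => isClosed_le (by fun_prop) continuous_const
    · simp only [Set.ofPred_forall]
      exact isClosed_iInter fun j => isClosed_le (by fun_prop) continuous_const
  · intro x hx i _ j _
    exact ⟨hx.nonneg i j, (Finset.single_le_sum (fun i _ => hx.nonneg i j)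
      (Finset.mem_univ i)).trans (hx.offline j)⟩

theorem exists_isOptimal : ∃ x, G.IsOptimal x := by
  have hcont : Continuous G.objective := by
    unfold objective
    fun_prop
  obtain ⟨x, hx, hmax⟩ := G.isCompact_isFeasible.exists_isMaxOn ⟨0, G.isFeasible_zero⟩
    hcont.continuousOn
  exact ⟨x, hx, fun x' hx' => hmax hx'⟩

/-- The value of the offline optimum is attained. -/
theorem exists_isMatching_optValue (n : I → ℕ) :
    ∃ M, G.IsMatching n M ∧ G.optValue n = ∑ e ∈ M, G.weight e.1.1 e.2 := by
  have hfin : {W : ℝ | ∃ M, G.IsMatching n M ∧ W = ∑ e ∈ M, G.weight e.1.1 e.2}.Finite := by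
    refine (Set.finite_range fun M : Finset ((Σ i, Fin (n i)) × J) =>
      ∑ e ∈ M, G.weight e.1.1 e.2).subset ?_
    rintro W ⟨M, _, rfl⟩
    exact ⟨M, rfl⟩
  have hne : {W : ℝ | ∃ M, G.IsMatching n M ∧ W = ∑ e ∈ M, G.weight e.1.1 e.2}.Nonempty :=
    ⟨0, ∅, by simp [IsMatching], by simp⟩
  exact hne.csSup_mem hfin

/-- A matching of maximum weight between the arrived online vertices and the offline vertices. -/
def optMatching (n : I → ℕ) : Finset ((Σ i, Fin (n i)) × J) :=
  (G.exists_isMatching_optValue n).choose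

theorem isMatching_optMatching (n : I → ℕ) : G.IsMatching n (G.optMatching n) :=
  (G.exists_isMatching_optValue n).choose_spec.1

open Classical in
/-- The number of edges between the type `i` and `j` in the optimal matching. -/
def optCount (n : I → ℕ) (i : I) (j : J) : ℕ :=
  ({e ∈ G.optMatching n | e.1.1 = i ∧ e.2 = j} : Finset _).card

theorem optValue_eq (n : I → ℕ) :
    G.optValue n = ∑ i, ∑ j, G.weight i j * G.optCount n i j := by
  classical
  rw [(G.exists_isMatching_optValue n).choose_spec.2]
  change ∑ e ∈ G.optMatching n, _ = _
  rw [← Finset.sum_product', Finset.univ_product_univ,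
    ← Finset.sum_fiberwise (G.optMatching n) (fun e => (e.1.1, e.2))]
  refine Finset.sum_congr rfl fun p _ => ?_
  have : ∀ e ∈ (G.optMatching n).filter (fun e => (e.1.1, e.2) = p),
      G.weight e.1.1 e.2 = G.weight p.1 p.2 := by
    intro e he
    rw [← (Finset.mem_filter.1 he).2]
  rw [Finset.sum_congr rfl this, Finset.sum_const, nsmul_eq_mul, mul_comm, optCount]
  simp_rw [← Prod.mk.injEq]

theorem optCount_eq_zero {n : I → ℕ} {i : I} {j : J} (h : ¬ G.Adj i j) :
    G.optCount n i j = 0 := by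
  classical
  rw [optCount, Finset.card_eq_zero, Finset.filter_eq_empty_iff]
  rintro e he ⟨rfl, rfl⟩
  exact h ((G.isMatching_optMatching n).1 e he)

open Classical in
theorem sum_optCount_offline (n : I → ℕ) (S : Finset I) (j : J) :
    ∑ i ∈ S, G.optCount n i j = ({e ∈ G.optMatching n | e.1.1 ∈ S ∧ e.2 = j} : Finset _).card := by
  rw [Finset.card_eq_sum_card_fiberwise (f := fun e => e.1.1) (t := S)
    (fun e he => (Finset.mem_filter.1 he).2.1)]
  refine Finset.sum_congr rfl fun i hi => ?_
  rw [optCount, Finset.filter_filter]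
  congr 1
  ext e
  simp only [Finset.mem_filter]
  constructor
  · rintro ⟨h, rfl, h2⟩
    exact ⟨h, ⟨hi, h2⟩, rfl⟩
  · rintro ⟨h, ⟨-, h2⟩, h1⟩
    exact ⟨h, h1, h2⟩

theorem sum_optCount_le_one (n : I → ℕ) (S : Finset I) (j : J) :
    ∑ i ∈ S, G.optCount n i j ≤ 1 := by
  classical
  rw [sum_optCount_offline, Finset.card_le_one]
  intro e he e' he'
  rw [Finset.mem_filter] at he he'
  exact (G.isMatching_optMatching n).2.2 e he.1 e' he'.1 (he.2.2.trans he'.2.2.symm)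

theorem sum_optCount_eq_zero {n : I → ℕ} {S : Finset I} (h : ∀ i ∈ S, n i = 0) (j : J) :
    ∑ i ∈ S, G.optCount n i j = 0 := by
  classical
  rw [sum_optCount_offline, Finset.card_eq_zero, Finset.filter_eq_empty_iff]
  rintro ⟨⟨i, k⟩, j'⟩ _ ⟨hi, _⟩
  have := k.2
  have := h i hi
  omega

theorem sum_optCount_online (n : I → ℕ) (i : I) : ∑ j, G.optCount n i j ≤ n i := by
  classical
  have : ∑ j, G.optCount n i j = ({e ∈ G.optMatching n | e.1.1 = i} : Finset _).card := by
    rw [Finset.card_eq_sum_card_fiberwise (f := fun e => e.2) (t := Finset.univ)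
      (fun e _ => Finset.mem_coe.2 (Finset.mem_univ _))]
    refine Finset.sum_congr rfl fun j _ => ?_
    rw [optCount, Finset.filter_filter]
  rw [this]
  calc _ ≤ (Finset.univ.map (Function.Embedding.sigmaMk (β := fun i => Fin (n i)) i)).card := by
        refine Finset.card_le_card_of_injOn (fun e => e.1) ?_ ?_
        · rintro ⟨⟨i', k⟩, j'⟩ he
          obtain rfl : i' = i := (Finset.mem_filter.1 he).2
          simp
        · intro e he e' he' h
          exact (G.isMatching_optMatching n).2.1 e (Finset.mem_filter.1 he).1 e'
            (Finset.mem_filter.1 he').1 h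
    _ = n i := by simp

/-- How many online vertices of each type have arrived. -/
def counts (ω : I → Arrivals Unit) (i : I) : ℕ := (ω i).1

theorem measurable_counts : Measurable (counts (I := I)) :=
  measurable_pi_lambda _ fun i => measurable_sigma_fst.comp (measurable_pi_apply i)

theorem measurable_comp_counts {Z : Type*} [MeasurableSpace Z] (f : (I → ℕ) → Z) :
    Measurable fun ω => f (counts ω) :=
  (measurable_of_countable f).comp measurable_counts

theorem rate_mul_dirac_univ (i : I) :
    (G.rate i : ℝ≥0∞) * (Measure.dirac () : Measure Unit) Set.univ = G.rate i := by simp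

theorem arrivalLaw_eq :
    G.arrivalLaw = poissonProcesses G.rate fun _ => (Measure.dirac () : Measure Unit) := rfl

instance : IsProbabilityMeasure G.arrivalLaw :=
  isProbabilityMeasure_poissonProcesses G.rate_mul_dirac_univ

theorem lintegral_counts (i : I) : ∫⁻ ω, (counts ω i : ℝ≥0∞) ∂G.arrivalLaw = G.rate i := by
  classical
  have h := lintegral_sum_erase_poissonProcesses G.rate_mul_dirac_univ i
    (F := fun _ => 1) measurable_const
  have hp : IsProbabilityMeasure
      (poissonProcesses G.rate fun _ => (Measure.dirac () : Measure Unit)) :=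
    isProbabilityMeasure_poissonProcesses G.rate_mul_dirac_univ
  simpa [pointLaw_univ, ← arrivalLaw_eq, counts] using h

open Classical in
/-- With probability `exp (-λ(S))` no online vertex of a type in `S` arrives. -/
theorem arrivalLaw_forall_counts_eq_zero (S : Finset I) :
    G.arrivalLaw.real {ω | ∀ i ∈ S, counts ω i = 0} = Real.exp (-∑ i ∈ S, (G.rate i : ℝ)) := by
  have h := poissonProcesses_avoids G.rate_mul_dirac_univ
    (A := fun i => if i ∈ S then Set.univ else ∅) (fun i => by split_ifs <;> simp)
  have hset : {ω : I → Arrivals Unit | ∀ i ∈ S, counts ω i = 0} =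
      {ω | ∀ i, (ω i).Avoids (if i ∈ S then Set.univ else ∅)} := by
    ext ω
    refine forall_congr' fun i => ?_
    by_cases hi : i ∈ S
    · simp only [hi, forall_const, if_true, Arrivals.Avoids, Set.mem_univ, not_true]
      rw [counts]
      constructor
      · intro h0 k
        exact absurd k.2 (by omega)
      · intro h0
        by_contra hne
        exact h0 ⟨0, Nat.pos_of_ne_zero hne⟩
    · simp [hi, Arrivals.Avoids]
  rw [measureReal_def, hset, arrivalLaw_eq, h, ENNReal.toReal_ofReal (Real.exp_pos _).le]
  congr 2
  rw [← Finset.sum_filter_add_sum_filter_not Finset.univ (· ∈ S)]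
  have h1 : ∀ i ∈ Finset.univ.filter (· ∈ S), (G.rate i : ℝ) *
      (pointLaw (Measure.dirac () : Measure Unit)).real (if i ∈ S then Set.univ else ∅) =
      G.rate i := by
    intro i hi
    rw [if_pos (Finset.mem_filter.1 hi).2, measureReal_def, pointLaw_univ]
    simp
  have h2 : ∀ i ∈ Finset.univ.filter (· ∉ S), (G.rate i : ℝ) *
      (pointLaw (Measure.dirac () : Measure Unit)).real (if i ∈ S then Set.univ else ∅) = 0 := by
    intro i hi
    rw [if_neg (Finset.mem_filter.1 hi).2]
    simp
  rw [Finset.sum_congr rfl h1, Finset.sum_congr rfl h2]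
  simp

/-- The expected number of edges between the type `i` and `j` in the optimal matching. These
numbers form a feasible solution of the linear program. -/
def optFlow (i : I) (j : J) : ℝ := ∫ ω, (G.optCount (counts ω) i j : ℝ) ∂G.arrivalLaw

theorem integrable_optCount (i : I) (j : J) :
    Integrable (fun ω => (G.optCount (counts ω) i j : ℝ)) G.arrivalLaw := by
  refine Integrable.of_bound (C := 1)
    (measurable_comp_counts fun n => (G.optCount n i j : ℝ)).aestronglyMeasurable ?_
  refine Filter.Eventually.of_forall fun ω => ?_
  have := G.sum_optCount_le_one (counts ω) {i} j
  rw [Finset.sum_singleton] at this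
  simpa using this

theorem sum_optFlow_offline (S : Finset I) (j : J) :
    ∑ i ∈ S, G.optFlow i j =
      ∫ ω, ((∑ i ∈ S, G.optCount (counts ω) i j : ℕ) : ℝ) ∂G.arrivalLaw := by
  simp_rw [optFlow, Nat.cast_sum]
  exact (integral_finsetSum _ fun i _ => G.integrable_optCount i j).symm

theorem sum_optFlow_online (i : I) : ∑ j, G.optFlow i j ≤ G.rate i := by
  have hint : Integrable (fun ω => ∑ j, (G.optCount (counts ω) i j : ℝ)) G.arrivalLaw :=
    integrable_finsetSum _ fun j _ => G.integrable_optCount i j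
  simp_rw [optFlow]
  rw [← integral_finsetSum _ fun j _ => G.integrable_optCount i j,
    ← ENNReal.ofReal_le_ofReal_iff (NNReal.coe_nonneg _), ENNReal.ofReal_coe_nnreal,
    ofReal_integral_eq_lintegral_ofReal hint
      (Filter.Eventually.of_forall fun ω => Finset.sum_nonneg fun j _ => Nat.cast_nonneg _),
    ← G.lintegral_counts i]
  refine lintegral_mono fun ω => ?_
  rw [← Nat.cast_sum, ENNReal.ofReal_natCast]
  exact Nat.cast_le.2 (G.sum_optCount_online (counts ω) i)

/-- The optimal matching matches `j` to a type in `S` only if some such type arrives. -/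
theorem sum_optFlow_le (S : Finset I) (j : J) :
    ∑ i ∈ S, G.optFlow i j ≤ 1 - Real.exp (-∑ i ∈ S, (G.rate i : ℝ)) := by
  classical
  have hmeas : MeasurableSet {ω : I → Arrivals Unit | ∀ i ∈ S, counts ω i = 0} :=
    measurableSet_setOfPred.2 (measurable_comp_counts fun n => ∀ i ∈ S, n i = 0)
  rw [← arrivalLaw_forall_counts_eq_zero, ← probReal_compl_eq_one_sub hmeas,
    ← integral_indicator_one hmeas.compl, sum_optFlow_offline]
  refine integral_mono_of_nonneg (Filter.Eventually.of_forall fun ω => Nat.cast_nonneg _)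
    ((integrable_const (1 : ℝ)).indicator hmeas.compl) (Filter.Eventually.of_forall fun ω => ?_)
  by_cases h : ∀ i ∈ S, counts ω i = 0
  · change ((∑ i ∈ S, G.optCount (counts ω) i j : ℕ) : ℝ) ≤ _
    rw [G.sum_optCount_eq_zero h, Nat.cast_zero]
    exact Set.indicator_nonneg (fun _ _ => zero_le_one) _
  · rw [Set.indicator_of_mem (by exact h)]
    exact Nat.cast_le_one.2 (G.sum_optCount_le_one (counts ω) S j)

theorem isFeasible_optFlow : G.IsFeasible G.optFlow where
  nonneg i j := integral_nonneg fun ω => Nat.cast_nonneg _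
  support i j h := by simp [optFlow, G.optCount_eq_zero h]
  online := G.sum_optFlow_online
  offline j := (G.sum_optFlow_le Finset.univ j).trans 
    (sub_le_self _ (Real.exp_pos _).le)
  jailletLu j := by
    classical
    have hmax : ∀ i, max (2 * G.optFlow i j - G.rate i) 0 =
        if 0 < 2 * G.optFlow i j - G.rate i then 2 * G.optFlow i j - G.rate i else 0 := by
      intro i
      split_ifs with h
      · exact max_eq_left h.le
      · exact max_eq_right (not_lt.1 h)
    simp_rw [hmax]
    rw [← Finset.sum_filter, Finset.sum_sub_distrib, ← Finset.mul_sum]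
    set S := Finset.univ.filter fun i => 0 < 2 * G.optFlow i j - G.rate i
    have h1 := G.sum_optFlow_le S j
    set Λ := ∑ i ∈ S, (G.rate i : ℝ)
    -- `2 (1 - exp (-Λ)) - Λ` is largest for `Λ = log 2`
    have h2 := Real.add_one_le_exp (Real.log 2 - Λ)
    rw [sub_eq_add_neg, Real.exp_add, Real.exp_log two_pos] at h2
    linarith

theorem integrable_offlineOpt : Integrable G.offlineOpt G.arrivalLaw := by
  have : G.offlineOpt = fun ω => ∑ i, ∑ j, G.weight i j * G.optCount (counts ω) i j := by
    ext ω
    exact G.optValue_eq (counts ω)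
  rw [this]
  exact integrable_finsetSum _ fun i _ => integrable_finsetSum _ fun j _ =>
    (G.integrable_optCount i j).const_mul _

theorem integral_offlineOpt : ∫ ω, G.offlineOpt ω ∂G.arrivalLaw = G.objective G.optFlow := by
  have : G.offlineOpt = fun ω => ∑ i, ∑ j, G.weight i j * G.optCount (counts ω) i j := by
    ext ω
    exact G.optValue_eq (counts ω)
  rw [this, integral_finsetSum _ fun i _ => integrable_finsetSum _ fun j _ =>
    (G.integrable_optCount i j).const_mul _, objective]
  refine Finset.sum_congr rfl fun i _ => ?_
  rw [integral_finsetSum _ fun j _ => (G.integrable_optCount i j).const_mul _]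
  exact Finset.sum_congr rfl fun j _ => integral_const_mul _ _

/-- The optimum of the linear program is an upper bound for the expected offline optimum. -/
theorem integral_offlineOpt_le {x : I → J → ℝ} (hx : G.IsOptimal x) :
    ∫ ω, G.offlineOpt ω ∂G.arrivalLaw ≤ G.objective x := by
  rw [integral_offlineOpt]
  exact hx.2 _ G.isFeasible_optFlow

end StochInstance

/-! ### Preprocessing of a fractional matching -/

theorem sum_volume_inter_Ico {c : ℕ → ℝ} (hc : Monotone c) {A : Set ℝ}
    (n : ℕ) : ∑ k ∈ Finset.range n, volume.real (A ∩ Set.Ico (c k) (c (k + 1))) =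
      volume.real (A ∩ Set.Ico (c 0) (c n)) := by
  induction n with
  | zero => simp
  | succ n ih =>
    have hne : ∀ a b : ℝ, volume (A ∩ Set.Ico a b) ≠ ∞ := fun a b =>
      measure_ne_top_of_subset Set.inter_subset_right (by simp)
    have hdisj : volume.real (A ∩ Set.Ico (c 0) (c (n + 1)) ∩ Set.Iio (c n)) +
        volume.real ((A ∩ Set.Ico (c 0) (c (n + 1))) \ Set.Iio (c n)) =
        volume.real (A ∩ Set.Ico (c 0) (c (n + 1))) :=
      measureReal_inter_add_sdiff measurableSet_Iio (hne _ _)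
    have h0 := hc (Nat.zero_le n)
    have h1 := hc (Nat.le_succ n)
    rw [Finset.sum_range_succ, ih, ← hdisj]
    congr 2 <;> ext p <;> simp only [Set.mem_inter_iff, Set.mem_Ico, Set.mem_Iio, Set.mem_sdiff]
    · constructor
      · rintro ⟨h, h2, h3⟩
        exact ⟨⟨h, h2, h3.trans_le h1⟩, h3⟩
      · rintro ⟨⟨h, h2, -⟩, h3⟩
        exact ⟨h, h2, h3⟩
    · constructor
      · rintro ⟨h, h2, h3⟩
        exact ⟨⟨h, h0.trans h2, h3⟩, not_lt.2 h2⟩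
      · rintro ⟨⟨h, -, h3⟩, h2⟩
        exact ⟨h, not_lt.1 h2, h3⟩

/-- Amounts `x v` can be realized by pairs, where the pair `(v, w)` has weight `ρ v w` and gives half
of it to each of its two members, such that only as much weight as necessary is on pairs `(v, v)`.
Lay out intervals of the lengths `x v` one after the other, and fold the union in the middle:
`ρ v w` is twice the length of the part of the interval of `v` that comes to lie on the interval
of `w`. The interval of `v` meets its own shifted copy only if it is longer than half of the
total. -/
theorem exists_pairing {V : Type*} [Fintype V] {x : V → ℝ} (hx : ∀ v, 0 ≤ x v) :
    ∃ ρ : V → V → ℝ, (∀ v w, 0 ≤ ρ v w) ∧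
      (∀ v, ∑ w, ρ v w + ∑ w, ρ w v = 2 * x v) ∧
      ∀ v, ρ v v ≤ max (2 * x v - ∑ w, x w) 0 := by
  let n := Fintype.card V
  let e : V ≃ Fin n := Fintype.equivFin V
  let y : ℕ → ℝ := fun k => if h : k < n then x (e.symm ⟨k, h⟩) else 0
  have hy0 : ∀ k, 0 ≤ y k := fun k => by
    simp only [y]; split_ifs
    · exact hx _
    · exact le_rfl
  have hye : ∀ v, y (e v) = x v := fun v => by simp [y]
  let c : ℕ → ℝ := fun k => ∑ i ∈ Finset.range k, y i
  have hc : Monotone c := monotone_nat_of_le_succ fun k => by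
    simp only [c, Finset.sum_range_succ]
    linarith [hy0 k]
  have hcs : ∀ k, c (k + 1) = c k + y k := fun k => Finset.sum_range_succ _ _
  have hc0 : c 0 = 0 := by simp [c]
  have hsum : ∀ f : ℕ → ℝ, ∑ v, f (e v) = ∑ k ∈ Finset.range n, f k := fun f => by
    rw [Equiv.sum_comp e (fun k : Fin n => f k), Finset.sum_range]
  have hcn : c n = ∑ v, x v := by
    simp only [c]
    rw [← hsum]
    exact Finset.sum_congr rfl fun v _ => hye v
  set h := (∑ v, x v) / 2 with hh
  have hcn' : c n = 2 * h := by rw [hcn, hh]; ring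
  let S : ℕ → Set ℝ := fun k => Set.Ico (c k) (c (k + 1))
  let S' : ℕ → Set ℝ := fun k => Set.Ico (c k - h) (c (k + 1) - h)
  let B : Set ℝ := Set.Ico 0 h
  have hh0 : 0 ≤ h := by
    have := hc (Nat.zero_le n)
    linarith
  refine ⟨fun v w => 2 * volume.real ((S (e v) ∩ B) ∩ S' (e w)), fun v w => by positivity,
    fun v => ?_, fun v => ?_⟩
  · have hrow : ∑ w, volume.real ((S (e v) ∩ B) ∩ S' (e w)) = volume.real (S (e v) ∩ B) := by
      rw [hsum fun k => volume.real ((S (e v) ∩ B) ∩ S' k)]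
      have hmono : Monotone fun k => c k - h := fun a b hab => sub_le_sub_right (hc hab) h
      refine (sum_volume_inter_Ico hmono n).trans ?_
      congr 1
      rw [Set.inter_eq_left]
      rintro p ⟨-, hp⟩
      exact ⟨by linarith [hp.1], by linarith [hp.2]⟩
    have hcol : ∑ w, volume.real ((S (e w) ∩ B) ∩ S' (e v)) = volume.real (B ∩ S' (e v)) := by
      rw [hsum fun k => volume.real ((S k ∩ B) ∩ S' (e v))]
      have hcomm : ∀ k, (S k ∩ B) ∩ S' (e v) = (B ∩ S' (e v)) ∩ S k := fun k => by
        rw [Set.inter_assoc, Set.inter_comm]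
      simp_rw [hcomm]
      refine (sum_volume_inter_Ico hc n).trans ?_
      congr 1
      rw [Set.inter_eq_left]
      rintro p ⟨hp, -⟩
      exact ⟨by linarith [hp.1], by linarith [hp.2]⟩
    rw [← Finset.mul_sum, ← Finset.mul_sum, hrow, hcol]
    simp only [S, S', B, Set.Ico_inter_Ico, Real.volume_real_Ico]
    have h1 := hc (Nat.zero_le (e v : ℕ))
    have h2 := hc (Nat.succ_le_of_lt (e v).2)
    have h3 := hcs (e v)
    rw [hye] at h3
    have h4 := hx v
    simp only [Nat.succ_eq_add_one] at h2
    rw [h3] at h2 ⊢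
    rw [hc0] at h1
    rw [hcn'] at h2
    generalize c (e v) = a at *
    have e1 : a ⊔ 0 = a := max_eq_left h1
    rw [e1]
    rcases le_total a h with ha | ha <;> rcases le_total (a + x v) h with hb | hb
    · rw [min_eq_left hb, max_eq_left (a := 0) (by linarith), min_eq_right (by linarith),
        max_eq_left (b := 0) (by linarith), max_eq_right (b := 0) (by linarith)]
      ring
    · rw [min_eq_right hb, max_eq_left (a := 0) (by linarith), min_eq_right (by linarith),
        max_eq_left (b := 0) (by linarith), max_eq_left (b := 0) (by linarith)]
      ring
    · have : x v = 0 := by linarith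
      have : a = h := by linarith
      subst this
      simp [*]
    · rw [min_eq_right hb, max_eq_right (a := 0) (by linarith), min_eq_right (by linarith),
        max_eq_right (b := 0) (by linarith), max_eq_left (b := 0) (by linarith)]
      ring
  · have hsub : (S (e v) ∩ B) ∩ S' (e v) ⊆ Set.Ico (c (e v)) (c (e v + 1) - h) :=
      fun p hp => ⟨hp.1.1.1, hp.2.2⟩
    have := measureReal_mono (μ := volume) hsub (by simp)
    rw [Real.volume_real_Ico, hcs, hye] at this
    calc _ ≤ 2 * max (c (e v) + x v - h - c (e v)) 0 := by simpa using this
      _ = max (2 * x v - ∑ w, x w) 0 := by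
        rw [mul_max_of_nonneg _ _ zero_le_two]
        congr 1
        · rw [hh]; ring
        · ring

namespace StochInstance

variable {I J : Type*} [Fintype I] [Fintype J] {G : StochInstance I J}

open Classical in
/-- A fractional matching that saturates every offline vertex and every online type can be split. -/
theorem nonempty_preprocessed_of_saturated {x : I → J → ℝ} (D : ℕ)
    {X : Option I → J ⊕ Fin D → ℝ} (h0 : ∀ s v, 0 ≤ X s v)
    (hx : ∀ i j, X (some i) (Sum.inl j) = x i j) (hrate : ∀ i, ∑ v, X (some i) v = G.rate i)
    (hoff : ∀ v, ∑ s, X s v = 1)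
    (hjl : ∀ v, ∑ s, max (2 * X s v - ∑ w, X s w) 0 ≤ 1 - Real.log 2) :
    Nonempty (G.Preprocessed x) := by
  choose ρ hρ0 hρsum hρdiag using fun s => exists_pairing (h0 s)
  let U := Option I × (J ⊕ Fin D) × (J ⊕ Fin D)
  let e : U ≃ Fin (Fintype.card U) := Fintype.equivFin U
  let fl : U → J ⊕ Fin D → ℝ := fun p v =>
    ρ p.1 p.2.1 p.2.2 / 2 * ((if p.2.1 = v then 1 else 0) + if p.2.2 = v then 1 else 0)
  have hsum : ∀ f : U → ℝ, ∑ u, f (e.symm u) = ∑ s, ∑ a, ∑ b, f (s, a, b) := fun f => by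
    rw [Equiv.sum_comp e.symm f, Fintype.sum_prod_type]
    exact Finset.sum_congr rfl fun s _ => Fintype.sum_prod_type _
  have hsum' : ∀ (f : U → ℝ) (i : I),
      ∑ u with (e.symm u).1 = some i, f (e.symm u) = ∑ a, ∑ b, f (some i, a, b) := by
    intro f i
    rw [Finset.sum_filter, hsum fun p => if p.1 = some i then f p else 0,
      Finset.sum_eq_single (some i)]
    · simp
    · intro s _ hs
      simp [hs]
    · simp
  have hflow : ∀ s v, ∑ a, ∑ b, fl (s, a, b) v = X s v := by
    intro s v
    have : ∀ a b, fl (s, a, b) v =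
        (if a = v then ρ s a b else 0) / 2 + (if b = v then ρ s a b else 0) / 2 := by
      intro a b
      simp only [fl]
      split_ifs <;> ring
    simp_rw [this, Finset.sum_add_distrib, ← Finset.sum_div]
    have h1 : ∑ a, ∑ b, (if a = v then ρ s a b else 0) = ∑ b, ρ s v b := by
      rw [Finset.sum_comm]
      simp
    have h2 : ∑ a, ∑ b, (if b = v then ρ s a b else 0) = ∑ a, ρ s a v := by
      simp
    rw [h1, h2, ← add_div, hρsum]
    ring
  have htotal : ∀ s, ∑ a, ∑ b, ρ s a b = ∑ v, X s v := by
    intro s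
    have h1 : ∑ v, ∑ w, ρ s v w + ∑ v, ∑ w, ρ s w v = 2 * ∑ v, X s v := by
      rw [← Finset.sum_add_distrib, Finset.mul_sum]
      exact Finset.sum_congr rfl fun v _ => hρsum s v
    rw [Finset.sum_comm (f := fun v w => ρ s w v)] at h1
    linarith
  refine ⟨{
    numTypes := Fintype.card U
    numDummy := D
    orig := fun u => (e.symm u).1
    rate := fun u => (ρ (e.symm u).1 (e.symm u).2.1 (e.symm u).2.2).toNNReal
    flow := fun u v => fl (e.symm u) v
    flow_nonneg := ?_
    split_rate := ?_
    split_flow := ?_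
    online := ?_
    offline := ?_
    discrete := ?_
    jailletLu := ?_ }⟩
  · intro u v
    have := hρ0 (e.symm u).1 (e.symm u).2.1 (e.symm u).2.2
    simp only [fl]
    split_ifs <;> positivity
  · intro i
    rw [← NNReal.coe_inj, NNReal.coe_sum]
    simp_rw [Real.coe_toNNReal _ (hρ0 _ _ _)]
    refine (hsum' (fun p => ρ p.1 p.2.1 p.2.2) i).trans ?_
    rw [htotal, hrate]
  · intro i j
    rw [hsum' (fun p => fl p (Sum.inl j)) i, hflow, hx]
  · intro u
    simp only [fl]
    rw [← Finset.mul_sum, Finset.sum_add_distrib]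
    simp only [Finset.sum_ite_eq, Finset.mem_univ, if_true]
    rw [Real.coe_toNNReal _ (hρ0 _ _ _)]
    ring
  · intro v
    rw [hsum fun p => fl p v]
    simp_rw [hflow]
    exact hoff v
  · intro u v
    rw [Real.coe_toNNReal _ (hρ0 _ _ _)]
    simp only [fl]
    split_ifs
    · exact Or.inr (Or.inr (by ring))
    · exact Or.inr (Or.inl (by ring))
    · exact Or.inr (Or.inl (by ring))
    · exact Or.inl (by ring)
  · intro v
    simp_rw [Real.coe_toNNReal _ (hρ0 _ _ _)]
    refine le_trans (le_of_eq (hsum fun p => max (2 * fl p v - ρ p.1 p.2.1 p.2.2) 0)) ?_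
    refine le_trans (Finset.sum_le_sum fun s _ => ?_) (hjl v)
    refine le_trans (le_of_eq ?_) (hρdiag s v)
    have hterm : ∀ a b, max (2 * fl (s, a, b) v - ρ s a b) 0 =
        if a = v then (if b = v then ρ s a b else 0) else 0 := by
      intro a b
      have := hρ0 s a b
      simp only [fl]
      split_ifs
      · rw [max_eq_left (by linarith)]; ring
      · rw [max_eq_right (by linarith)]
      · rw [max_eq_right (by linarith)]
      · rw [max_eq_right (by linarith)]
    simp_rw [hterm]
    rw [Finset.sum_comm]
    simp

/-- Every feasible solution has a preprocessing: the unused rates of the online types go in equal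
parts to many dummy offline vertices, and the dummy online type supplies what the offline vertices
lack. With enough dummy vertices no new edge uses more than half of the rate of its type. -/
theorem nonempty_preprocessed {x : I → J → ℝ} (hx : G.IsFeasible x) :
    Nonempty (G.Preprocessed x) := by
  classical
  let rest : I → ℝ := fun i => G.rate i - ∑ j, x i j
  have hrest : ∀ i, 0 ≤ rest i := fun i => sub_nonneg.2 (hx.online i)
  have hrest' : ∀ i, rest i ≤ G.rate i := fun i =>
    sub_le_self _ (Finset.sum_nonneg fun j _ => hx.nonneg i j)
  let L := ∑ i, rest i
  have hL : 0 ≤ L := Finset.sum_nonneg fun i _ => hrest i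
  let D : ℕ := ⌈L⌉₊ + 2
  have hD : L + 2 ≤ (D : ℝ) := by
    have := Nat.le_ceil L
    simp only [D]; push_cast; linarith
  have hD0 : (0 : ℝ) < D := by linarith
  let X : Option I → J ⊕ Fin D → ℝ := fun s v => match s, v with
    | some i, Sum.inl j => x i j
    | some i, Sum.inr _ => rest i / D
    | none, Sum.inl j => 1 - ∑ i, x i j
    | none, Sum.inr _ => 1 - L / D
  have hXrate : ∀ i, ∑ v, X (some i) v = G.rate i := by
    intro i
    rw [Fintype.sum_sum_type]
    simp only [X, Finset.sum_const, Finset.card_univ, Fintype.card_fin, nsmul_eq_mul]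
    rw [mul_div_cancel₀ _ hD0.ne']
    simp [rest]
  have hXnone : D - L ≤ ∑ v, X none v := by
    rw [Fintype.sum_sum_type]
    simp only [X, Finset.sum_const, Finset.card_univ, Fintype.card_fin, nsmul_eq_mul]
    rw [mul_sub, mul_div_cancel₀ _ hD0.ne']
    have : 0 ≤ ∑ j, (1 - ∑ i, x i j) :=
      Finset.sum_nonneg fun j _ => sub_nonneg.2 (hx.offline j)
    linarith
  have hX1 : ∀ v, X none v ≤ 1 := by
    rintro (j | d)
    · exact sub_le_self _ (Finset.sum_nonneg fun i _ => hx.nonneg i j)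
    · exact sub_le_self _ (by positivity)
  refine nonempty_preprocessed_of_saturated D (X := X) ?_ (fun _ _ => rfl) hXrate ?_ ?_
  · rintro (_ | i) (j | d)
    · exact sub_nonneg.2 (hx.offline j)
    · exact sub_nonneg.2 ((div_le_one hD0).2 (by linarith))
    · exact hx.nonneg i j
    · exact div_nonneg (hrest i) hD0.le
  · rintro (j | d)
    · rw [Fintype.sum_option]
      simp [X]
    · rw [Fintype.sum_option]
      simp only [X]
      rw [← Finset.sum_div]
      simp [L]
  · intro v
    rw [Fintype.sum_option, max_eq_right (by linarith [hX1 v]), zero_add]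
    simp_rw [hXrate]
    rcases v with j | d
    · exact hx.jailletLu j
    · have : ∀ i, max (2 * X (some i) (Sum.inr d) - G.rate i) 0 = 0 := by
        intro i
        refine max_eq_right (sub_nonpos.2 ?_)
        have : 2 * (rest i / D) ≤ rest i := by
          rw [← mul_div_assoc, div_le_iff₀ hD0, mul_comm]
          exact mul_le_mul_of_nonneg_left (by linarith) (hrest i)
        exact this.trans (hrest' i)
      simp_rw [this]
      simp only [Finset.sum_const_zero]
      linarith [Real.log_two_lt_d9]

namespace Preprocessed

variable {x : I → J → ℝ} {P : G.Preprocessed x}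

/-! ### Runs of the algorithm -/

section Fold

variable {ω : P.Sample} {m : P.Offline → Option (Vertex ω)} {v : P.Offline} {a : Vertex ω}

theorem tryMatch_of_matched (h : m v = some a) (b : Vertex ω) (T : Option P.Offline) :
    tryMatch m b T v = some a := by
  classical
  cases T with
  | none => exact h
  | some w =>
    simp only [tryMatch]
    split_ifs with hw
    · rw [Function.update_of_ne, h]
      rintro rfl
      simp [hw] at h
    · exact h

theorem tryMatch_of_ne {T : Option P.Offline} (h : T ≠ some v) (b : Vertex ω) :
    tryMatch m b T v = m v := by
  classical
  cases T with
  | none => rfl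
  | some w =>
    simp only [tryMatch]
    split_ifs
    · rw [Function.update_of_ne]
      rintro rfl
      exact h rfl
    · rfl

theorem tryMatch_of_unmatched (h : m v = none) (b : Vertex ω) :
    tryMatch m b (some v) v = some b := by
  simp [tryMatch, h]

variable {T : Vertex ω → Option P.Offline} {l : List (Vertex ω)}

theorem foldl_of_matched (h : m v = some a) :
    l.foldl (fun m b => tryMatch m b (T b)) m v = some a := by
  induction l generalizing m with
  | nil => exact h
  | cons b l ih => exact ih (tryMatch_of_matched h b (T b))

theorem foldl_of_ne (h : ∀ b ∈ l, T b ≠ some v) :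
    l.foldl (fun m b => tryMatch m b (T b)) m v = m v := by
  induction l generalizing m with
  | nil => rfl
  | cons b l ih =>
    rw [List.foldl_cons, ih fun c hc => h c (List.mem_cons_of_mem _ hc),
      tryMatch_of_ne (h b List.mem_cons_self)]

/-- The offline vertex `v` is matched to the first online vertex that is to be matched to it. -/
theorem foldl_eq_of_first (hs : l.Pairwise fun b c => time ω b ≤ time ω c) (hd : l.Nodup)
    (ha : a ∈ l) (hT : T a = some v) (hm : m v = none)
    (h : ∀ b ∈ l, b ≠ a → time ω b ≤ time ω a → T b ≠ some v) :
    l.foldl (fun m b => tryMatch m b (T b)) m v = some a := by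
  obtain ⟨l₁, l₂, rfl⟩ := List.append_of_mem ha
  rw [List.pairwise_append] at hs
  rw [List.nodup_append] at hd
  rw [List.foldl_append, List.foldl_cons, hT]
  refine foldl_of_matched (tryMatch_of_unmatched ?_ a)
  rw [foldl_of_ne, hm]
  exact fun b hb => h b (List.mem_append_left _ hb) (hd.2.2 b hb a List.mem_cons_self)
    (hs.2.2 b hb a List.mem_cons_self)

theorem foldl_ne_none (ha : a ∈ l) (hT : T a = some v) :
    l.foldl (fun m b => tryMatch m b (T b)) m v ≠ none := by
  obtain ⟨l₁, l₂, rfl⟩ := List.append_of_mem ha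
  rw [List.foldl_append, List.foldl_cons, hT]
  set m' := l₁.foldl (fun m b => tryMatch m b (T b)) m
  cases h : m' v with
  | none => simp [foldl_of_matched (tryMatch_of_unmatched h a)]
  | some b => simp [foldl_of_matched (tryMatch_of_matched h a (some v))]

theorem target_of_foldl_eq (h : l.foldl (fun m b => tryMatch m b (T b)) m v = some a) :
    m v = some a ∨ T a = some v := by
  induction l generalizing m with
  | nil => exact Or.inl h
  | cons b l ih =>
    rcases ih h with h' | h'
    · replace h' : tryMatch m b (T b) v = some a := h'
      by_cases hb : T b = some v
      · cases hm : m v with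
        | none =>
          rw [hb, tryMatch_of_unmatched hm] at h'
          exact Or.inr (by rw [← Option.some_inj.1 h', hb])
        | some c => exact Or.inl (by rw [← h', tryMatch_of_matched hm])
      · exact Or.inl (by rw [← h', tryMatch_of_ne hb])
    · exact Or.inr h'

end Fold

theorem mem_arrivalOrder (ω : P.Sample) (a : Vertex ω) : a ∈ arrivalOrder ω := by
  simp [arrivalOrder]

theorem nodup_arrivalOrder (ω : P.Sample) : (arrivalOrder ω).Nodup :=
  ((Finset.univ.toList).mergeSort_perm _).nodup_iff.2 (Finset.nodup_toList _)

theorem pairwise_arrivalOrder (ω : P.Sample) :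
    (arrivalOrder ω).Pairwise fun a b => time ω a ≤ time ω b := by
  have h := List.pairwise_mergeSort (le := fun a b => decide (time ω a ≤ time ω b))
    (by simpa using fun a b c => le_trans) (by simpa using fun a b => le_total _ _)
    (Finset.univ : Finset (Vertex ω)).toList
  exact h.imp (by simp)

/-- Arrivals of type `u` at the time `t` are not discarded: `u` is first-class, or `t` is after
`t₀`. -/
def Active (P : G.Preprocessed x) (t₀ t : ℝ) (u : Fin P.numTypes) : Prop :=
  P.FirstClass u ∨ t₀ < t

section Target

variable {t₀ t₁ : ℝ} {ω : P.Sample} {a : Vertex ω} {v : P.Offline}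

theorem earlyTarget_eq_iff : earlyTarget t₀ ω a = some v ↔
    (mark ω a).coin = v ∧ P.Active t₀ (time ω a) (mark ω a).typ := by
  unfold earlyTarget Active
  split_ifs with h1 h2
  · simp [h1]
  · simp [h1, h2]
  · simp [h1, not_le.1 h2]

theorem lateTarget_mem {m : P.Offline → Option (Vertex ω)} (h : lateTarget m a = some v) :
    v ∈ P.neighbors (mark ω a).typ := by
  classical
  unfold lateTarget at h
  split_ifs at h with h1 h2
  · rw [← Option.some_inj.1 h]; exact (mark ω a).coin_mem
  · have := h2.choose_spec
    rw [Option.some_inj.1 h] at this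
    have hv : v ∈ ({v} : Finset P.Offline) := Finset.mem_singleton_self v
    rw [← this] at hv
    exact (Finset.mem_filter.1 hv).1
  · rw [← Option.some_inj.1 h]; exact (mark ω a).coin_mem

theorem lateTarget_of_coin {m : P.Offline → Option (Vertex ω)} (hm : m v = none)
    (hc : (mark ω a).coin = v) : lateTarget m a = some v := by
  classical
  unfold lateTarget
  split_ifs with h1 h2
  · rw [hc]
  · have hv : v ∈ ({v' ∈ P.neighbors (mark ω a).typ | m v' = none} : Finset _) :=
      Finset.mem_filter.2 ⟨hc ▸ (mark ω a).coin_mem, hm⟩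
    rw [h2.choose_spec, Finset.mem_singleton] at hv
    rw [← hv]
  · rw [hc]

theorem lateTarget_of_neighbors {m : P.Offline → Option (Vertex ω)} {v' : P.Offline}
    (hu : ¬ P.FirstClass (mark ω a).typ) (hv : v ∈ P.neighbors (mark ω a).typ)
    (hn : ∀ w ∈ P.neighbors (mark ω a).typ, w = v ∨ w = v')
    (hm : m v = none) (hm' : m v' ≠ none) : lateTarget m a = some v := by
  classical
  have hset : ({w ∈ P.neighbors (mark ω a).typ | m w = none} : Finset _) = {v} := by
    ext w
    simp only [Finset.mem_filter, Finset.mem_singleton]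
    constructor
    · rintro ⟨hw, h⟩
      rcases hn w hw with rfl | rfl
      · rfl
      · exact absurd h hm'
    · rintro rfl
      exact ⟨hv, hm⟩
  have hex : ∃ w, ({w' ∈ P.neighbors (mark ω a).typ | m w' = none} : Finset _) = {w} := ⟨v, hset⟩
  unfold lateTarget
  rw [if_neg hu, dif_pos hex]
  exact congrArg some (Finset.singleton_inj.1 (hset.symm.trans hex.choose_spec)).symm

theorem pairwise_filter_arrivalOrder (ω : P.Sample) (p : Vertex ω → Bool) :
    ((arrivalOrder ω).filter p).Pairwise fun a b => time ω a ≤ time ω b :=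
  (pairwise_arrivalOrder ω).sublist List.filter_sublist

theorem nodup_filter_arrivalOrder (ω : P.Sample) (p : Vertex ω → Bool) :
    ((arrivalOrder ω).filter p).Nodup :=
  (nodup_arrivalOrder ω).sublist List.filter_sublist

theorem stateAt_ne_none {b : Vertex ω} (hb : time ω b ≤ t₁) (hc : (mark ω b).coin = v)
    (hact : P.Active t₀ (time ω b) (mark ω b).typ) : stateAt t₀ t₁ ω v ≠ none :=
  foldl_ne_none (List.mem_filter.2 ⟨mem_arrivalOrder ω b, by simpa using hb⟩)
    (earlyTarget_eq_iff.2 ⟨hc, hact⟩)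

/-- The algorithm matches only along edges of positive flow. -/
theorem mem_neighbors_of_output (h : output t₀ t₁ ω v = some a) :
    v ∈ P.neighbors (mark ω a).typ := by
  rcases target_of_foldl_eq h with h | h
  · rcases target_of_foldl_eq h with h | h
    · simp at h
    · rw [← (earlyTarget_eq_iff.1 h).1]
      exact (mark ω a).coin_mem
  · exact lateTarget_mem h

/-- An arrival of type `u` with coin `c` at the time `τ` may be matched to `v`, and this happens no
later than at the time `t`. Up to `t₁` this means that the coin is `v`. After `t₁` an arrival may
be matched to any of its neighbors, depending on the state at time `t₁`, and all second-class
arrivals with neighbor `v` are counted; this makes the condition independent of that state. -/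
def blockers (P : G.Preprocessed x) (t₀ t₁ : ℝ) (v : P.Offline) (t : ℝ) (τ : ℝ)
    (u : Fin P.numTypes) (c : P.Offline) : Prop :=
  τ ≤ t ∧ (c = v ∧ P.Active t₀ τ u ∨ t₁ < τ ∧ c ≠ v ∧ v ∈ P.neighbors u)

/-- An arrival with coin `v` before `t₁` is matched to `v` if it is active and not preceded by a
possible competitor for `v`. -/
theorem output_eq_of_early (ht : time ω a ≤ t₁) (hc : (mark ω a).coin = v)
    (hact : P.Active t₀ (time ω a) (mark ω a).typ)
    (h : ∀ b, b ≠ a →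
      ¬ P.blockers t₀ t₁ v (time ω a) (time ω b) (mark ω b).typ (mark ω b).coin) :
    output t₀ t₁ ω v = some a := by
  refine foldl_of_matched ?_
  refine foldl_eq_of_first (pairwise_filter_arrivalOrder ω _) (nodup_filter_arrivalOrder ω _)
    (List.mem_filter.2 ⟨mem_arrivalOrder ω a, by simpa using ht⟩)
    (earlyTarget_eq_iff.2 ⟨hc, hact⟩) rfl ?_
  intro b _ hba hta hT
  exact h b hba ⟨hta, Or.inl (earlyTarget_eq_iff.1 hT)⟩

theorem stateAt_eq_none (ht : t₁ < time ω a)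
    (h : ∀ b, b ≠ a →
      ¬ P.blockers t₀ t₁ v (time ω a) (time ω b) (mark ω b).typ (mark ω b).coin) :
    stateAt t₀ t₁ ω v = none := by
  refine foldl_of_ne fun b hb hT => ?_
  have hb' : time ω b ≤ t₁ := by simpa using (List.mem_filter.1 hb).2
  refine h b ?_ ⟨by linarith, Or.inl (earlyTarget_eq_iff.1 hT)⟩
  rintro rfl
  linarith

theorem output_eq_of_late (h₀₁ : t₀ ≤ t₁) (ht : t₁ < time ω a)
    (hT : lateTarget (stateAt t₀ t₁ ω) a = some v)
    (h : ∀ b, b ≠ a →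
      ¬ P.blockers t₀ t₁ v (time ω a) (time ω b) (mark ω b).typ (mark ω b).coin) :
    output t₀ t₁ ω v = some a := by
  refine foldl_eq_of_first (pairwise_filter_arrivalOrder ω _) (nodup_filter_arrivalOrder ω _)
    (List.mem_filter.2 ⟨mem_arrivalOrder ω a, by simpa using ht⟩) hT (stateAt_eq_none ht h) ?_
  intro b hb hba hta hTb
  have hb' : t₁ < time ω b := by simpa using (List.mem_filter.1 hb).2
  refine h b hba ⟨hta, ?_⟩
  by_cases hc : (mark ω b).coin = v
  · exact Or.inl ⟨hc, Or.inr (by linarith)⟩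
  · exact Or.inr ⟨hb', hc, lateTarget_mem hTb⟩

/-- An arrival with coin `v` is matched to `v` if it is active and not preceded by a possible
competitor for `v`. -/
theorem output_eq_of_coin (h₀₁ : t₀ ≤ t₁) (hc : (mark ω a).coin = v)
    (hact : P.Active t₀ (time ω a) (mark ω a).typ)
    (h : ∀ b, b ≠ a →
      ¬ P.blockers t₀ t₁ v (time ω a) (time ω b) (mark ω b).typ (mark ω b).coin) :
    output t₀ t₁ ω v = some a := by
  rcases le_or_gt (time ω a) t₁ with ht | ht
  · exact output_eq_of_early ht hc hact h
  · exact output_eq_of_late h₀₁ ht (lateTarget_of_coin (stateAt_eq_none ht h) hc) h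

/-- A second-class arrival after `t₁` is matched to its neighbor `v` whatever its coin, if the other
neighbor has been matched by the time `t₁`. -/
theorem output_eq_of_other (h₀₁ : t₀ ≤ t₁) {v' : P.Offline} (ht : t₁ < time ω a)
    (hu : ¬ P.FirstClass (mark ω a).typ) (hv : v ∈ P.neighbors (mark ω a).typ)
    (hn : ∀ w ∈ P.neighbors (mark ω a).typ, w = v ∨ w = v')
    (h : ∀ b, b ≠ a →
      ¬ P.blockers t₀ t₁ v (time ω a) (time ω b) (mark ω b).typ (mark ω b).coin)
    {b : Vertex ω} (hb : time ω b ≤ t₁) (hbc : (mark ω b).coin = v')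
    (hact : P.Active t₀ (time ω b) (mark ω b).typ) :
    output t₀ t₁ ω v = some a :=
  output_eq_of_late h₀₁ ht
    (lateTarget_of_neighbors hu hv hn (stateAt_eq_none ht h) (stateAt_ne_none hb hbc hact)) h

end Target

/-! ### Measurability of the outcome of the algorithm -/

instance (s : Option I) : Finite (P.Mark s) := by
  refine Finite.of_injective (fun m => (m.typ, m.coin)) ?_
  rintro ⟨u, hu, v, hv⟩ ⟨u', hu', v', hv'⟩ h
  simp only [Prod.mk.injEq] at h
  obtain ⟨rfl, rfl⟩ := h
  rfl

/-- The sample with `n s` arrivals of type `s`, whose times and marks are given by `y`. -/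
def sampleOf (n : Option I → ℕ) (y : ∀ s, Fin (n s) → ℝ × P.Mark s) : P.Sample :=
  fun s => ⟨n s, y s⟩

/-- The information about the arrivals that the algorithm uses when it is run with the boundary
times `t₀` and `t₁`: the order of the arrival times, the marks, and which times are at most `t₀` or
at most `t₁`. -/
def runData (t₀ t₁ : ℝ) (n : Option I → ℕ) (y : ∀ s, Fin (n s) → ℝ × P.Mark s) :
    ((Σ s, Fin (n s)) → (Σ s, Fin (n s)) → Prop) × (∀ a : Σ s, Fin (n s), P.Mark a.1) ×
      ((Σ s, Fin (n s)) → Prop) × ((Σ s, Fin (n s)) → Prop) :=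
  (fun a b => (y a.1 a.2).1 ≤ (y b.1 b.2).1, fun a => (y a.1 a.2).2,
    fun a => (y a.1 a.2).1 ≤ t₀, fun a => (y a.1 a.2).1 ≤ t₁)

theorem measurable_runData (t₀ t₁ : ℝ) (n : Option I → ℕ) :
    Measurable (runData (P := P) t₀ t₁ n) := by
  have hy : ∀ a : Σ s, Fin (n s),
      Measurable fun y : ∀ s, Fin (n s) → ℝ × P.Mark s => y a.1 a.2 := fun a =>
    (measurable_pi_apply a.2).comp (measurable_pi_apply a.1)
  refine Measurable.prodMk ?_ (Measurable.prodMk ?_ (Measurable.prodMk ?_ ?_))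
  · exact measurable_pi_lambda _ fun a => measurable_pi_lambda _ fun b =>
      measurableSet_setOfPred.1 (measurableSet_le (hy a).fst (hy b).fst)
  · exact measurable_pi_lambda _ fun a => (hy a).snd
  · exact measurable_pi_lambda _ fun a =>
      measurableSet_setOfPred.1 (measurableSet_le (hy a).fst measurable_const)
  · exact measurable_pi_lambda _ fun a =>
      measurableSet_setOfPred.1 (measurableSet_le (hy a).fst measurable_const)

section Congr

variable {t₀ t₁ : ℝ} {n : Option I → ℕ} {y y' : ∀ s, Fin (n s) → ℝ × P.Mark s}

theorem mark_congr (h : runData t₀ t₁ n y = runData t₀ t₁ n y') (a : Σ s, Fin (n s)) :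
    mark (sampleOf n y) a = mark (sampleOf n y') a :=
  congrFun (congrArg (fun d => d.2.1) h) a

theorem output_congr (h : runData t₀ t₁ n y = runData t₀ t₁ n y') :
    output t₀ t₁ (sampleOf n y) = output t₀ t₁ (sampleOf n y') := by
  have hle : ∀ a b : Σ s, Fin (n s), (time (sampleOf n y) a ≤ time (sampleOf n y) b) =
      (time (sampleOf n y') a ≤ time (sampleOf n y') b) := fun a b =>
    congrFun (congrFun (congrArg (fun d => d.1) h) a) b
  have h0 : ∀ a : Σ s, Fin (n s), (time (sampleOf n y) a ≤ t₀) =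
      (time (sampleOf n y') a ≤ t₀) := congrFun (congrArg (fun d => d.2.2.1) h)
  have h1 : ∀ a : Σ s, Fin (n s), (time (sampleOf n y) a ≤ t₁) =
      (time (sampleOf n y') a ≤ t₁) := congrFun (congrArg (fun d => d.2.2.2) h)
  have h1' : ∀ a : Σ s, Fin (n s), (t₁ < time (sampleOf n y) a) =
      (t₁ < time (sampleOf n y') a) := fun a => by
    rw [← not_le, ← not_le, h1]
  have hord : arrivalOrder (sampleOf n y) = arrivalOrder (sampleOf n y') := by
    refine congrArg (fun le => (Finset.univ : Finset (Σ s, Fin (n s))).toList.mergeSort le) ?_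
    ext a b
    exact decide_eq_decide.2 (iff_of_eq (hle a b))
  have hearly : ∀ a : Σ s, Fin (n s),
      earlyTarget t₀ (sampleOf n y) a = earlyTarget t₀ (sampleOf n y') a := by
    intro a
    unfold earlyTarget
    rw [mark_congr h]
    split_ifs with i1 i2 i3 i3
    · rfl
    · rfl
    · exact absurd ((h0 a).mp i2) i3
    · exact absurd ((h0 a).mpr i3) i2
    · rfl
  have hlate : ∀ (m : P.Offline → Option (Σ s, Fin (n s))) (a : Σ s, Fin (n s)),
      lateTarget (ω := sampleOf n y) m a = lateTarget (ω := sampleOf n y') m a := by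
    intro m a
    unfold lateTarget
    rw [mark_congr h]
    rfl
  have hstate : stateAt t₀ t₁ (sampleOf n y) = stateAt t₀ t₁ (sampleOf n y') := by
    refine congrArg₂ (fun (f : (P.Offline → Option (Σ s, Fin (n s))) → (Σ s, Fin (n s)) →
      P.Offline → Option (Σ s, Fin (n s))) l => List.foldl f (fun _ => none) l) ?_ ?_
    · ext1 m
      ext1 a
      exact congrArg (tryMatch (ω := sampleOf n y') m a) (hearly a)
    · refine congrArg₂ List.filter ?_ hord
      ext1 a
      exact decide_eq_decide.2 (iff_of_eq (h1 a))
  unfold output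
  have hfun : (fun (m : P.Offline → Option (Σ s, Fin (n s))) (a : Σ s, Fin (n s)) =>
      tryMatch (ω := sampleOf n y) m a (lateTarget (stateAt t₀ t₁ (sampleOf n y)) a)) =
      fun m a => tryMatch (ω := sampleOf n y') m a
        (lateTarget (stateAt t₀ t₁ (sampleOf n y')) a) := by
    ext1 m
    ext1 a
    refine congrArg (tryMatch (ω := sampleOf n y') m a) ?_
    exact (hlate _ a).trans
      (congrArg (fun m => lateTarget (ω := sampleOf n y') m a) hstate)
  have hlist : (arrivalOrder (sampleOf n y)).filter
        (fun a => decide (t₁ < time (sampleOf n y) a)) =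
      (arrivalOrder (sampleOf n y')).filter fun a => decide (t₁ < time (sampleOf n y') a) := by
    refine congrArg₂ List.filter ?_ hord
    ext1 a
    exact decide_eq_decide.2 (iff_of_eq (h1' a))
  exact congr (congr (congrArg List.foldl hfun) hstate) hlist

end Congr

/-- Whatever depends only on the data that the algorithm uses is measurable. -/
theorem measurable_of_runData (t₀ t₁ : ℝ) {Z : Type*} [MeasurableSpace Z] [Nonempty Z]
    {f : P.Sample → Z}
    (hf : ∀ n y y', runData t₀ t₁ n y = runData t₀ t₁ n y' →
      f (sampleOf n y) = f (sampleOf n y')) : Measurable f := by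
  refine measurable_pi_sigma fun n => ?_
  obtain ⟨z⟩ := ‹Nonempty Z›
  have hfac : (fun y => f (sampleOf n y)) =
      Function.extend (runData (P := P) t₀ t₁ n) (fun y => f (sampleOf n y)) (fun _ => z) ∘
        runData t₀ t₁ n := by
    ext y
    rw [Function.comp_apply, Function.FactorsThrough.extend_apply (fun y y' h => hf n y y' h)]
  change Measurable fun y => f (sampleOf n y)
  rw [hfac]
  exact (measurable_of_countable _).comp (measurable_runData t₀ t₁ n)

theorem measurableSet_edgeMatched (t₀ t₁ : ℝ) (u : Fin P.numTypes) (v : P.Offline) :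
    MeasurableSet {ω : P.Sample | EdgeMatched t₀ t₁ u v ω} := by
  refine measurableSet_setOfPred.2 (measurable_of_runData t₀ t₁ fun n y y' h => ?_)
  have h2 : mark (sampleOf n y) = mark (sampleOf n y') := funext (mark_congr h)
  exact congrArg₂ (fun (m : P.Offline → Option (Σ s, Fin (n s)))
    (k : ∀ a : Σ s, Fin (n s), P.Mark a.1) => ∃ a, m v = some a ∧ (k a).typ = u)
    (output_congr h) h2

/-! ### First-class and second-class types -/

theorem mem_neighbors {u : Fin P.numTypes} {v : P.Offline} :
    v ∈ P.neighbors u ↔ 0 < P.flow u v := by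
  simp [neighbors]

theorem flow_eq_zero {u : Fin P.numTypes} {v : P.Offline} (h : v ∉ P.neighbors u) :
    P.flow u v = 0 :=
  le_antisymm (not_lt.1 fun h' => h (mem_neighbors.2 h')) (P.flow_nonneg u v)

theorem flow_le_rate (u : Fin P.numTypes) (v : P.Offline) : P.flow u v ≤ P.rate u := by
  rw [← P.online u]
  exact Finset.single_le_sum (fun v _ => P.flow_nonneg u v) (Finset.mem_univ v)

theorem FirstClass.flow_eq_zero {u : Fin P.numTypes} (hu : P.FirstClass u) {v w : P.Offline}
    (hv : v ∈ P.neighbors u) (hw : w ≠ v) : P.flow u w = 0 := by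
  classical
  obtain ⟨v₀, hv₀, hrate⟩ := hu
  have h0 : ∀ w ≠ v₀, P.flow u w = 0 := by
    intro w hw
    have h := Finset.sum_le_sum_of_subset_of_nonneg (Finset.subset_univ {v₀, w})
      (fun v _ _ => P.flow_nonneg u v)
    rw [Finset.sum_pair hw.symm, P.online u, hrate] at h
    exact le_antisymm (by linarith) (P.flow_nonneg u w)
  obtain rfl : v = v₀ := by
    by_contra hne
    exact (mem_neighbors.1 hv).ne' (h0 v hne)
  exact h0 w hw

theorem FirstClass.flow_eq_rate {u : Fin P.numTypes} (hu : P.FirstClass u) {v : P.Offline}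
    (hv : v ∈ P.neighbors u) : P.flow u v = P.rate u := by
  rw [← P.online u, Finset.sum_eq_single v (fun w _ hw => hu.flow_eq_zero hv hw)]
  simp

theorem flow_eq_half_rate {u : Fin P.numTypes} (hu : ¬ P.FirstClass u) {v : P.Offline}
    (hv : v ∈ P.neighbors u) : P.flow u v = P.rate u / 2 := by
  rcases P.discrete u v with h | h | h
  · exact absurd h (mem_neighbors.1 hv).ne'
  · exact h
  · exact absurd ⟨v, hv, h⟩ hu

/-- The flow of a type is spread evenly over its neighbors. -/
theorem flow_mul_card {u : Fin P.numTypes} {v : P.Offline} (hv : v ∈ P.neighbors u) :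
    P.flow u v * (P.neighbors u).card = P.rate u := by
  have hsum : ∑ w ∈ P.neighbors u, P.flow u w = P.rate u := by
    rw [← P.online u]
    exact Finset.sum_subset (Finset.subset_univ _) fun w _ hw => Preprocessed.flow_eq_zero hw
  have hconst : ∀ w ∈ P.neighbors u, P.flow u w = P.flow u v := by
    intro w hw
    by_cases hu : P.FirstClass u
    · rw [hu.flow_eq_rate hw, hu.flow_eq_rate hv]
    · rw [flow_eq_half_rate hu hw, flow_eq_half_rate hu hv]
  rw [Finset.sum_congr rfl hconst, Finset.sum_const, nsmul_eq_mul] at hsum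
  rw [mul_comm, hsum]

theorem exists_other_neighbor {u : Fin P.numTypes} (hu : ¬ P.FirstClass u) {v : P.Offline}
    (hv : v ∈ P.neighbors u) :
    ∃ v', v' ≠ v ∧ P.flow u v' = P.flow u v ∧ ∀ w ∈ P.neighbors u, w = v ∨ w = v' := by
  classical
  have hcard : (P.neighbors u).card = 2 := by
    have h1 := flow_mul_card hv
    have h2 := flow_eq_half_rate hu hv
    have h3 := mem_neighbors.1 hv
    have h4 : ((P.neighbors u).card : ℝ) = 2 := by
      have : P.flow u v * ((P.neighbors u).card - 2) = 0 := by linarith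
      rcases mul_eq_zero.1 this with h | h
      · exact absurd h h3.ne'
      · linarith
    exact_mod_cast h4
  have hcard' : ((P.neighbors u).erase v).card = 1 := by
    rw [Finset.card_erase_of_mem hv, hcard]
  obtain ⟨v', hv'⟩ := Finset.card_eq_one.1 hcard'
  have hmem : v' ∈ (P.neighbors u).erase v := by rw [hv']; exact Finset.mem_singleton_self v'
  refine ⟨v', Finset.ne_of_mem_erase hmem, ?_, fun w hw => ?_⟩
  · rw [flow_eq_half_rate hu hv, flow_eq_half_rate hu (Finset.mem_of_mem_erase hmem)]
  · by_cases h : w = v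
    · exact Or.inl h
    · exact Or.inr (Finset.mem_singleton.1 (hv' ▸ Finset.mem_erase.2 ⟨h, hw⟩))

/-! ### The intensity of the arrivals -/

theorem rate_le_sourceRate (u : Fin P.numTypes) : P.rate u ≤ P.sourceRate (P.orig u) := by
  classical
  have h : ∀ s, P.orig u = s → P.rate u ≤ P.sourceRate s := by
    rintro (_ | i) hs
    · exact Finset.single_le_sum (f := P.rate) (fun _ _ => zero_le)
        (Finset.mem_filter.2 ⟨Finset.mem_univ u, hs⟩)
    · rw [sourceRate, ← P.split_rate i]
      exact Finset.single_le_sum (f := P.rate) (fun _ _ => zero_le)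
        (Finset.mem_filter.2 ⟨Finset.mem_univ u, hs⟩)
  exact h _ rfl

open Classical in
theorem sourceRate_eq_sum (s : Option I) :
    P.sourceRate s = ∑ u with P.orig u = s, P.rate u := by
  cases s with
  | none => rfl
  | some i => exact (P.split_rate i).symm

instance (s : Option I) : IsFiniteMeasure (P.markLaw s) := by
  unfold markLaw
  infer_instance

theorem sourceRate_mul_weight {u : Fin P.numTypes} {v : P.Offline} (hv : v ∈ P.neighbors u) :
    (P.sourceRate (P.orig u) : ℝ≥0∞) *
      ((P.rate u / P.sourceRate (P.orig u) * ((P.neighbors u).card : ℝ≥0)⁻¹ : ℝ≥0) : ℝ≥0∞) =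
      ENNReal.ofReal (P.flow u v) := by
  rw [← ENNReal.coe_mul, ENNReal.ofReal, ENNReal.coe_inj]
  have hpos : 0 < P.rate u :=
    NNReal.coe_pos.1 ((mem_neighbors.1 hv).trans_le (flow_le_rate u v))
  have hs : P.sourceRate (P.orig u) ≠ 0 := (hpos.trans_le (rate_le_sourceRate u)).ne'
  have hc : ((P.neighbors u).card : ℝ≥0) ≠ 0 := by
    exact_mod_cast (Finset.card_pos.2 ⟨v, hv⟩).ne'
  have hr : P.rate u = (P.flow u v).toNNReal * (P.neighbors u).card := by
    rw [← NNReal.coe_inj]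
    push_cast
    rw [Real.coe_toNNReal _ (P.flow_nonneg u v), flow_mul_card hv]
  rw [← mul_assoc, mul_div_cancel₀ _ hs]
  nth_rewrite 1 [hr]
  rw [mul_assoc, mul_inv_cancel₀ hc, mul_one]

open Classical in
/-- For every part `u` of the source `s`, the arrivals whose type is changed to `u` and whose coin is
`v` have the intensity `flow u v`, since the flow of `u` is spread evenly over its neighbors. -/
theorem lintegral_pointLaw_markLaw (s : Option I) {F : ℝ → Fin P.numTypes → P.Offline → ℝ≥0∞}
    (hF : ∀ u v, Measurable fun τ => F τ u v) :
    P.sourceRate s * ∫⁻ p, F p.1 p.2.typ p.2.coin ∂pointLaw (P.markLaw s) =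
      ∑ u with P.orig u = s, ∑ v, ENNReal.ofReal (P.flow u v) *
        ∫⁻ τ in Set.Icc 0 1, F τ u v := by
  have hmeas : Measurable fun p : ℝ × P.Mark s => F p.1 p.2.typ p.2.coin :=
    measurable_from_prod_countable_left fun m => hF m.typ m.coin
  have hin : ∀ τ, ∫⁻ m, F τ m.typ m.coin ∂P.markLaw s =
      ∑ u : {u // P.orig u = s}, ∑ v : {v // v ∈ P.neighbors u},
        ((P.rate u / P.sourceRate s * ((P.neighbors u).card : ℝ≥0)⁻¹ : ℝ≥0) : ℝ≥0∞) *
          F τ u v := by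
    intro τ
    rw [markLaw, lintegral_finsetSum_measure]
    refine Finset.sum_congr rfl fun u _ => ?_
    rw [lintegral_finsetSum_measure]
    refine Finset.sum_congr rfl fun v _ => ?_
    rw [lintegral_smul_measure, lintegral_dirac]
    rfl
  rw [pointLaw, lintegral_prod _ hmeas.aemeasurable]
  simp_rw [hin]
  have hterm : ∀ (u : {u // P.orig u = s}) (v : {v // v ∈ P.neighbors u}), Measurable fun τ =>
      ((P.rate u / P.sourceRate s * ((P.neighbors u).card : ℝ≥0)⁻¹ : ℝ≥0) : ℝ≥0∞) * F τ u v :=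
    fun u v => (hF u v).const_mul _
  have hsum : ∀ u : {u // P.orig u = s}, Measurable fun τ =>
      ∑ v : {v // v ∈ P.neighbors u},
        ((P.rate u / P.sourceRate s * ((P.neighbors u).card : ℝ≥0)⁻¹ : ℝ≥0) : ℝ≥0∞) *
          F τ u v := fun u => Finset.measurable_sum _ fun v _ => hterm u v
  rw [lintegral_finsetSum _ fun u _ => hsum u, Finset.mul_sum, ← Finset.sum_subtype_eq_sum_filter]
  simp only [Finset.subtype_univ]
  refine Finset.sum_congr rfl fun u _ => ?_
  rw [lintegral_finsetSum _ fun v _ => hterm u v, Finset.mul_sum]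
  have hsub : ∑ v, ENNReal.ofReal (P.flow u v) * ∫⁻ τ in Set.Icc 0 1, F τ u v =
      ∑ v ∈ P.neighbors u, ENNReal.ofReal (P.flow u v) * ∫⁻ τ in Set.Icc 0 1, F τ u v := by
    refine (Finset.sum_subset (Finset.subset_univ _) fun v _ hv => ?_).symm
    rw [Preprocessed.flow_eq_zero hv]
    simp
  rw [hsub, ← Finset.sum_coe_sort (P.neighbors u)]
  refine Finset.sum_congr rfl fun v _ => ?_
  obtain ⟨u, rfl⟩ := u
  rw [lintegral_const_mul _ (hF u v), ← mul_assoc, sourceRate_mul_weight v.2]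

/-- The marks have a probability law, except for sources of rate `0`, for which `markLaw` is the
zero measure because of the division by `0`. -/
theorem sourceRate_mul_markLaw_univ (s : Option I) :
    (P.sourceRate s : ℝ≥0∞) * P.markLaw s Set.univ = P.sourceRate s := by
  classical
  have h := lintegral_pointLaw_markLaw s (F := fun (_ : ℝ) (_ : Fin P.numTypes) _ => 1)
    fun _ _ => measurable_const
  simp only [lintegral_const, one_mul, pointLaw_univ, Measure.restrict_apply_univ,
    Real.volume_Icc, sub_zero, ENNReal.ofReal_one, mul_one] at h
  rw [h, sourceRate_eq_sum, ENNReal.ofNNReal_finsetSum]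
  refine Finset.sum_congr rfl fun u _ => ?_
  rw [← ENNReal.ofReal_sum_of_nonneg fun v _ => P.flow_nonneg u v, P.online,
    ENNReal.ofReal_coe_nnreal]

theorem law_eq : P.law = poissonProcesses P.sourceRate P.markLaw := rfl

instance : IsProbabilityMeasure P.law :=
  isProbabilityMeasure_poissonProcesses sourceRate_mul_markLaw_univ

/-- The expected number of arrivals whose time, split type and coin satisfy `A`. -/
def intensity (P : G.Preprocessed x) (A : ℝ → Fin P.numTypes → P.Offline → Prop) : ℝ :=
  ∑ u, ∑ v, P.flow u v * volume.real (Set.Icc 0 1 ∩ {τ | A τ u v})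

/-- No arrival satisfies `A`. -/
def Avoids (ω : P.Sample) (A : ℝ → Fin P.numTypes → P.Offline → Prop) : Prop :=
  ∀ s, (ω s).Avoids {p | A p.1 p.2.typ p.2.coin}

theorem measurableSet_markSet {A : ℝ → Fin P.numTypes → P.Offline → Prop}
    (hA : ∀ u v, MeasurableSet {τ | A τ u v}) (s : Option I) :
    MeasurableSet {p : ℝ × P.Mark s | A p.1 p.2.typ p.2.coin} :=
  measurableSet_setOfPred.2 (measurable_from_prod_countable_left fun m =>
    measurableSet_setOfPred.1 (hA m.typ m.coin))

theorem law_avoids {A : ℝ → Fin P.numTypes → P.Offline → Prop}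
    (hA : ∀ u v, MeasurableSet {τ | A τ u v}) :
    P.law {ω | Avoids ω A} = ENNReal.ofReal (Real.exp (-P.intensity A)) := by
  classical
  refine (poissonProcesses_avoids sourceRate_mul_markLaw_univ
    (measurableSet_markSet hA)).trans ?_
  congr 3
  have hs : ∀ s, (P.sourceRate s : ℝ) *
      (pointLaw (P.markLaw s)).real {p | A p.1 p.2.typ p.2.coin} =
      ∑ u with P.orig u = s, ∑ v, P.flow u v * volume.real (Set.Icc 0 1 ∩ {τ | A τ u v}) := by
    intro s
    have h := lintegral_pointLaw_markLaw (P := P) s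
      (F := fun τ u v => {τ | A τ u v}.indicator 1 τ)
      fun u v => measurable_one.indicator (hA u v)
    have h1 : ∫⁻ p, {τ | A τ p.2.typ p.2.coin}.indicator 1 p.1 ∂pointLaw (P.markLaw s) =
        pointLaw (P.markLaw s) {p | A p.1 p.2.typ p.2.coin} :=
      lintegral_indicator_one (measurableSet_markSet hA s)
    have h2 : ∀ u v, ∫⁻ τ in Set.Icc 0 1, {τ | A τ u v}.indicator 1 τ =
        volume (Set.Icc 0 1 ∩ {τ | A τ u v}) := by
      intro u v
      rw [lintegral_indicator_one (hA u v), Measure.restrict_apply (hA u v), Set.inter_comm]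
    rw [h1] at h
    simp_rw [h2] at h
    have h3 := congrArg ENNReal.toReal h
    have hne : ∀ u v, volume (Set.Icc 0 1 ∩ {τ | A τ u v}) ≠ ∞ := fun u v =>
      measure_ne_top_of_subset Set.inter_subset_left (by simp)
    rw [ENNReal.toReal_mul, ENNReal.toReal_sum fun u _ => ENNReal.sum_ne_top.2 fun v _ =>
      ENNReal.mul_ne_top ENNReal.ofReal_ne_top (hne u v)] at h3
    refine h3.trans (Finset.sum_congr rfl fun u _ => ?_)
    rw [ENNReal.toReal_sum fun v _ => ENNReal.mul_ne_top ENNReal.ofReal_ne_top (hne u v)]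
    refine Finset.sum_congr rfl fun v _ => ?_
    rw [ENNReal.toReal_mul, ENNReal.toReal_ofReal (P.flow_nonneg u v)]
    rfl
  rw [Finset.sum_congr rfl fun s _ => hs s, intensity,
    Finset.sum_fiberwise Finset.univ P.orig fun u =>
      ∑ v, P.flow u v * volume.real (Set.Icc 0 1 ∩ {τ | A τ u v})]

theorem measurableSet_sampleAvoids {A : ℝ → Fin P.numTypes → P.Offline → Prop}
    (hA : ∀ u v, MeasurableSet {τ | A τ u v}) : MeasurableSet {ω : P.Sample | Avoids ω A} := by
  simp only [Avoids, Set.ofPred_forall]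
  refine MeasurableSet.iInter fun s => ?_
  have h : Measurable fun ω : P.Sample => ω s := measurable_pi_apply s
  exact h (measurableSet_avoids (measurableSet_markSet hA s))

/-! ### Lower bounds for the probability that an edge is matched -/

open Classical in
theorem not_of_avoids_erase {ω : P.Sample} {s : Option I} {k : Fin (ω s).1}
    {A : ℝ → Fin P.numTypes → P.Offline → Prop}
    (h : Avoids (Function.update ω s ((ω s).erase k)) A) {b : Vertex ω} (hb : b ≠ ⟨s, k⟩) :
    ¬ A (time ω b) (mark ω b).typ (mark ω b).coin := by
  obtain ⟨s', l⟩ := b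
  have hs := h s'
  by_cases hs' : s' = s
  · subst hs'
    rw [Function.update_self] at hs
    obtain ⟨l', hl'⟩ := (ω s').exists_erase_of_ne (k := k) (l := l) fun h => hb (by rw [h])
    have := hs l'
    rw [hl'] at this
    exact this
  · rw [Function.update_of_ne hs'] at hs
    exact hs l

open Classical in
theorem exists_of_not_avoids_erase {ω : P.Sample} {s : Option I} {k : Fin (ω s).1}
    {A : ℝ → Fin P.numTypes → P.Offline → Prop}
    (h : ¬ Avoids (Function.update ω s ((ω s).erase k)) A) :
    ∃ b : Vertex ω, A (time ω b) (mark ω b).typ (mark ω b).coin := by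
  simp only [Avoids, not_forall] at h
  obtain ⟨s', hs⟩ := h
  by_cases hs' : s' = s
  · subst hs'
    rw [Function.update_self] at hs
    simp only [Arrivals.Avoids, not_forall, not_not] at hs
    obtain ⟨l', hl'⟩ := hs
    obtain ⟨l, hl⟩ := (ω s').exists_of_erase k l'
    rw [← hl] at hl'
    exact ⟨⟨s', l⟩, hl'⟩
  · rw [Function.update_of_ne hs'] at hs
    simp only [Arrivals.Avoids, not_forall, not_not] at hs
    obtain ⟨l, hl⟩ := hs
    exact ⟨⟨s', l⟩, hl⟩

/-- The arrivals up to the time `t₁` that the algorithm tries to match to `w`. -/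
def claims (P : G.Preprocessed x) (t₀ t₁ : ℝ) (w : P.Offline) (τ : ℝ) (u : Fin P.numTypes)
    (c : P.Offline) : Prop :=
  τ ≤ t₁ ∧ c = w ∧ P.Active t₀ τ u

/-- A sufficient condition for an arrival `p` of type `u` to be matched to `v`, where `ω` are the
other arrivals: nothing that precedes `p` may be matched to `v`, and `p` itself either has the
coin `v` or arrives after `t₁`, when its other neighbor is no longer available. -/
def Succeeds (t₀ t₁ : ℝ) (u : Fin P.numTypes) (v : P.Offline) {s : Option I}
    (p : ℝ × P.Mark s) (ω : P.Sample) : Prop :=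
  p.2.typ = u ∧ Avoids ω (P.blockers t₀ t₁ v p.1) ∧
    (p.2.coin = v ∧ P.Active t₀ p.1 u ∨
      p.2.coin ≠ v ∧ ¬ P.FirstClass u ∧ t₁ < p.1 ∧ ¬ Avoids ω (P.claims t₀ t₁ p.2.coin))

variable {t₀ t₁ : ℝ} {u : Fin P.numTypes} {v : P.Offline}

open Classical in
theorem output_eq_of_succeeds (h₀₁ : t₀ ≤ t₁) (hv : v ∈ P.neighbors u) {ω : P.Sample}
    {s : Option I} {k : Fin (ω s).1}
    (h : Succeeds t₀ t₁ u v ((ω s).2 k) (Function.update ω s ((ω s).erase k))) :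
    output t₀ t₁ ω v = some ⟨s, k⟩ ∧ (mark ω ⟨s, k⟩).typ = u := by
  obtain ⟨htyp, havoid, h⟩ := h
  replace htyp : (mark ω ⟨s, k⟩).typ = u := htyp
  have hblock : ∀ b : Vertex ω, b ≠ ⟨s, k⟩ → ¬ P.blockers t₀ t₁ v (time ω ⟨s, k⟩) (time ω b)
      (mark ω b).typ (mark ω b).coin := fun b hb => not_of_avoids_erase havoid hb
  refine ⟨?_, htyp⟩
  rcases h with ⟨hc, hact⟩ | ⟨hc, hu, ht, hclaim⟩
  · exact output_eq_of_coin h₀₁ hc (by rw [htyp]; exact hact) hblock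
  · obtain ⟨b, hb, hbc, hact⟩ := exists_of_not_avoids_erase hclaim
    obtain ⟨v', -, -, hv'⟩ := exists_other_neighbor hu hv
    have hcoin : ((ω s).2 k).2.coin = v' := by
      refine (hv' _ ?_).resolve_left hc
      rw [← htyp]
      exact (mark ω ⟨s, k⟩).coin_mem
    refine output_eq_of_other h₀₁ (v' := v') ht (by rw [htyp]; exact hu) (by rw [htyp]; exact hv)
      (by rw [htyp]; exact hv') hblock hb (hbc.trans hcoin) hact

theorem measurableSet_blockers (t₀ t₁ τ : ℝ) (v : P.Offline) (u : Fin P.numTypes)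
    (c : P.Offline) : MeasurableSet {σ | P.blockers t₀ t₁ v τ σ u c} := by
  unfold blockers Active
  measurability

theorem measurableSet_claims (t₀ t₁ : ℝ) (w : P.Offline) (u : Fin P.numTypes)
    (c : P.Offline) : MeasurableSet {σ | P.claims t₀ t₁ w σ u c} := by
  unfold claims Active
  measurability

theorem measurableSet_avoids_blockers (t₀ t₁ : ℝ) (v : P.Offline) :
    MeasurableSet {q : ℝ × P.Sample | Avoids q.2 (P.blockers t₀ t₁ v q.1)} := by
  refine measurableSet_forall_avoids
    (A := fun s => {q : ℝ × (ℝ × P.Mark s) | P.blockers t₀ t₁ v q.1 q.2.1 q.2.2.typ q.2.2.coin})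
    fun s => ?_
  have h : Measurable fun q : (ℝ × ℝ) × P.Mark s =>
      P.blockers t₀ t₁ v q.1.1 q.1.2 q.2.typ q.2.coin := by
    refine measurable_from_prod_countable_left fun m => measurableSet_setOfPred.1 ?_
    have h1 : MeasurableSet {q : ℝ × ℝ | q.2 ≤ q.1} :=
      measurableSet_le measurable_snd measurable_fst
    have h2 : MeasurableSet {q : ℝ × ℝ | t₀ < q.2} :=
      measurableSet_lt measurable_const measurable_snd
    have h3 : MeasurableSet {q : ℝ × ℝ | t₁ < q.2} :=
      measurableSet_lt measurable_const measurable_snd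
    exact h1.inter (((MeasurableSet.const (m.coin = v)).inter
      ((MeasurableSet.const (P.FirstClass m.typ)).union h2)).union
      (h3.inter (.const (m.coin ≠ v ∧ v ∈ P.neighbors m.typ))))
  exact measurableSet_setOfPred.2 (h.comp ((measurable_fst.prodMk (measurable_fst.comp
    measurable_snd)).prodMk (measurable_snd.comp measurable_snd)))

theorem measurableSet_succeeds (t₀ t₁ : ℝ) (u : Fin P.numTypes) (v : P.Offline) (s : Option I) :
    MeasurableSet {q : (ℝ × P.Mark s) × P.Sample | Succeeds t₀ t₁ u v q.1 q.2} := by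
  have hmark : ∀ p : P.Mark s → Prop,
      MeasurableSet {q : (ℝ × P.Mark s) × P.Sample | p q.1.2} := fun p =>
    (measurable_snd.comp measurable_fst) (MeasurableSet.of_discrete (s := {m | p m}))
  have htime : ∀ t, MeasurableSet {q : (ℝ × P.Mark s) × P.Sample | t < q.1.1} := fun t =>
    measurableSet_lt measurable_const (measurable_fst.comp measurable_fst)
  have hblock : MeasurableSet {q : (ℝ × P.Mark s) × P.Sample |
      Avoids q.2 (P.blockers t₀ t₁ v q.1.1)} :=
    ((measurable_fst.comp measurable_fst).prodMk measurable_snd)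
      (measurableSet_avoids_blockers t₀ t₁ v)
  have hclaim : Measurable fun q : P.Mark s × P.Sample =>
      Avoids q.2 (P.claims t₀ t₁ q.1.coin) :=
    measurable_from_prod_countable_right fun m => measurableSet_setOfPred.1
      (measurableSet_sampleAvoids fun u c => measurableSet_claims t₀ t₁ m.coin u c)
  have hclaim' : MeasurableSet {q : (ℝ × P.Mark s) × P.Sample |
      Avoids q.2 (P.claims t₀ t₁ q.1.2.coin)} :=
    measurableSet_setOfPred.2
      (hclaim.comp ((measurable_snd.comp measurable_fst).prodMk measurable_snd))
  exact (hmark fun m => m.typ = u).inter (hblock.inter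
    (((hmark fun m => m.coin = v).inter (MeasurableSet.union (.const _) (htime t₀))).union
      ((hmark fun m => m.coin ≠ v).inter (MeasurableSet.inter (.const _)
        ((htime t₁).inter hclaim'.compl)))))

/-- By Mecke's formula, the probability that the edge is matched is at least the integral over the
possible arrivals `p` of the probability that `p` succeeds. -/
theorem lintegral_succeeds_le (h₀₁ : t₀ ≤ t₁) (hv : v ∈ P.neighbors u) (s : Option I) :
    P.sourceRate s * ∫⁻ p, P.law {ω | Succeeds t₀ t₁ u v p ω} ∂pointLaw (P.markLaw s) ≤
      P.law {ω | EdgeMatched t₀ t₁ u v ω} := by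
  classical
  let 𝒮 := {q : (ℝ × P.Mark s) × P.Sample | Succeeds t₀ t₁ u v q.1 q.2}
  have h𝒮 : MeasurableSet 𝒮 := measurableSet_succeeds t₀ t₁ u v s
  have hmecke := lintegral_sum_erase_poissonProcesses
    (sourceRate_mul_markLaw_univ (P := P)) s (F := 𝒮.indicator 1) (measurable_one.indicator h𝒮)
  have hin : ∀ p, ∫⁻ ω, 𝒮.indicator 1 (p, ω) ∂P.law = P.law {ω | Succeeds t₀ t₁ u v p ω} :=
    fun p => lintegral_indicator_one (measurable_prodMk_left h𝒮)
  rw [← law_eq] at hmecke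
  simp_rw [hin] at hmecke
  rw [← hmecke, ← lintegral_indicator_one (measurableSet_edgeMatched t₀ t₁ u v)]
  refine lintegral_mono fun ω => ?_
  by_cases hex : ∃ k : Fin (ω s).1, ((ω s).2 k, Function.update ω s ((ω s).erase k)) ∈ 𝒮
  · obtain ⟨k, hk⟩ := hex
    have hout := output_eq_of_succeeds h₀₁ hv hk
    have hem : ω ∈ {ω : P.Sample | EdgeMatched t₀ t₁ u v ω} := ⟨⟨s, k⟩, hout⟩
    rw [Set.indicator_of_mem hem, Finset.sum_eq_single k]
    · exact Set.indicator_le_self' (fun _ _ => zero_le) _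
    · intro l _ hl
      refine Set.indicator_of_notMem (fun hl' => hl ?_) _
      have := (output_eq_of_succeeds h₀₁ hv hl').1.symm.trans hout.1
      simpa using this
    · simp
  · push Not at hex
    rw [Finset.sum_eq_zero fun k _ => Set.indicator_of_notMem (hex k) _]
    exact zero_le

open Classical in
/-- The total flow to `v` from first-class types. -/
def firstClassFlow (P : G.Preprocessed x) (v : P.Offline) : ℝ :=
  ∑ u, if P.FirstClass u then P.flow u v else 0

theorem firstClassFlow_nonneg (v : P.Offline) : 0 ≤ P.firstClassFlow v :=
  Finset.sum_nonneg fun u _ => by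
    split_ifs
    · exact P.flow_nonneg u v
    · exact le_rfl

theorem firstClassFlow_le (v : P.Offline) : P.firstClassFlow v ≤ 1 - Real.log 2 := by
  refine (Finset.sum_le_sum fun u _ => ?_).trans (P.jailletLu v)
  split_ifs with hu
  · by_cases hv : v ∈ P.neighbors u
    · refine le_max_of_le_left ?_
      rw [hu.flow_eq_rate hv]
      linarith
    · rw [Preprocessed.flow_eq_zero hv]
      exact le_max_right _ _
  · exact le_max_right _ _

/-- A bound for the intensity of the arrivals that may be matched to an offline vertex with
first-class flow `y` up to the time `τ`. -/
def blockingBound (t₀ t₁ y τ : ℝ) : ℝ :=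
  y * τ + (1 - y) * (max (τ - t₀) 0 + max (τ - t₁) 0)

theorem volume_real_inter_le {A : Set ℝ} {a b : ℝ} (h : A ⊆ Set.Icc a b) :
    volume.real (Set.Icc 0 1 ∩ A) ≤ max (b - a) 0 := by
  rw [← Real.volume_real_Icc]
  exact measureReal_mono (Set.inter_subset_right.trans h) (by simp)

theorem intensity_blockers_le {τ : ℝ} (hτ : 0 ≤ τ) :
    P.intensity (P.blockers t₀ t₁ v τ) ≤ blockingBound t₀ t₁ (P.firstClassFlow v) τ := by
  classical
  have hvol : ∀ u c, 0 ≤ volume.real (Set.Icc 0 1 ∩ {σ | P.blockers t₀ t₁ v τ σ u c}) :=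
    fun u c => measureReal_nonneg
  have hother : ∀ u c, c ≠ v →
      volume.real (Set.Icc 0 1 ∩ {σ | P.blockers t₀ t₁ v τ σ u c}) ≤ max (τ - t₁) 0 := by
    intro u c hc
    refine volume_real_inter_le ?_
    rintro σ ⟨h1, ⟨h2, -⟩ | ⟨h2, -⟩⟩
    · exact absurd h2 hc
    · exact ⟨h2.le, h1⟩
  have hu : ∀ u, ∑ c, P.flow u c *
      volume.real (Set.Icc 0 1 ∩ {σ | P.blockers t₀ t₁ v τ σ u c}) ≤
      (if P.FirstClass u then P.flow u v else 0) * τ +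
        (P.flow u v - if P.FirstClass u then P.flow u v else 0) *
          (max (τ - t₀) 0 + max (τ - t₁) 0) := by
    intro u
    by_cases hv : v ∈ P.neighbors u
    · rw [← Finset.add_sum_erase _ _ (Finset.mem_univ v)]
      split_ifs with hu
      · rw [Finset.sum_eq_zero fun c hc => by
          rw [hu.flow_eq_zero hv (Finset.ne_of_mem_erase hc), zero_mul]]
        have h : volume.real (Set.Icc 0 1 ∩ {σ | P.blockers t₀ t₁ v τ σ u v}) ≤ τ := by
          refine (measureReal_mono (s₂ := Set.Icc 0 τ) ?_ (by simp)).trans ?_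
          · rintro σ ⟨h1, h2⟩
            exact ⟨h1.1, h2.1⟩
          · rw [Real.volume_real_Icc_of_le hτ, sub_zero]
        have := mul_le_mul_of_nonneg_left h (P.flow_nonneg u v)
        linarith
      · have h : volume.real (Set.Icc 0 1 ∩ {σ | P.blockers t₀ t₁ v τ σ u v}) ≤
            max (τ - t₀) 0 := by
          refine volume_real_inter_le ?_
          rintro σ ⟨h1, ⟨-, h2 | h2⟩ | ⟨-, h2, -⟩⟩
          · exact absurd h2 hu
          · exact ⟨h2.le, h1⟩
          · exact absurd rfl h2
        have h1 := mul_le_mul_of_nonneg_left h (P.flow_nonneg u v)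
        have h2 : ∑ c ∈ Finset.univ.erase v, P.flow u c *
            volume.real (Set.Icc 0 1 ∩ {σ | P.blockers t₀ t₁ v τ σ u c}) ≤
            P.flow u v * max (τ - t₁) 0 := by
          have hrest : ∑ c ∈ Finset.univ.erase v, P.flow u c = P.flow u v := by
            have h3 := Finset.add_sum_erase Finset.univ (P.flow u) (Finset.mem_univ v)
            rw [P.online u] at h3
            have := flow_eq_half_rate hu hv
            linarith
          nth_rewrite 1 [← hrest]
          rw [Finset.sum_mul]
          exact Finset.sum_le_sum fun c hc => mul_le_mul_of_nonneg_left
            (hother u c (Finset.ne_of_mem_erase hc)) (P.flow_nonneg u c)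
        linarith
    · rw [Preprocessed.flow_eq_zero hv]
      simp only [ite_self, sub_zero, zero_mul, add_zero]
      refine (Finset.sum_eq_zero fun c _ => ?_).le
      by_cases hc : c = v
      · rw [hc, Preprocessed.flow_eq_zero hv, zero_mul]
      · have : {σ | P.blockers t₀ t₁ v τ σ u c} = ∅ := by
          ext σ
          simp only [Set.mem_empty_iff_false, iff_false]
          rintro ⟨-, ⟨h2, -⟩ | ⟨-, -, h2⟩⟩
          · exact hc h2
          · exact hv h2
        rw [this]
        simp
  refine (Finset.sum_le_sum fun u _ => hu u).trans (le_of_eq ?_)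
  rw [Finset.sum_add_distrib, ← Finset.sum_mul, ← Finset.sum_mul, Finset.sum_sub_distrib,
    P.offline v]
  rfl

theorem le_intensity_claims (h0 : 0 ≤ t₀) (h₀₁ : t₀ ≤ t₁) (h1 : t₁ ≤ 1) (w : P.Offline) :
    t₁ - t₀ ≤ P.intensity (P.claims t₀ t₁ w) := by
  have hsum : t₁ - t₀ = ∑ u, P.flow u w * (t₁ - t₀) := by
    rw [← Finset.sum_mul, P.offline w, one_mul]
  rw [hsum]
  refine Finset.sum_le_sum fun u _ => ?_
  refine le_trans ?_ (Finset.single_le_sum (f := fun c => P.flow u c *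
    volume.real (Set.Icc 0 1 ∩ {σ | P.claims t₀ t₁ w σ u c}))
    (fun c _ => mul_nonneg (P.flow_nonneg u c) measureReal_nonneg) (Finset.mem_univ w))
  refine mul_le_mul_of_nonneg_left ?_ (P.flow_nonneg u w)
  rw [← Real.volume_real_Ioc_of_le h₀₁]
  refine measureReal_mono ?_ (measure_ne_top_of_subset Set.inter_subset_left (by simp))
  rintro σ ⟨h2, h3⟩
  exact ⟨⟨by linarith, by linarith⟩, h3, rfl, Or.inr h2⟩

/-- The blockers of `v` and the claims to another vertex `w` are different arrivals. -/
theorem intensity_blockers_or_claims {τ : ℝ} {w : P.Offline} (hw : w ≠ v) :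
    P.intensity (fun σ u c => P.blockers t₀ t₁ v τ σ u c ∨ P.claims t₀ t₁ w σ u c) =
      P.intensity (P.blockers t₀ t₁ v τ) + P.intensity (P.claims t₀ t₁ w) := by
  simp_rw [intensity]
  rw [← Finset.sum_add_distrib]
  refine Finset.sum_congr rfl fun u _ => ?_
  rw [← Finset.sum_add_distrib]
  refine Finset.sum_congr rfl fun c _ => ?_
  rw [← mul_add]
  congr 1
  have hset : Set.Icc 0 1 ∩ {σ | P.blockers t₀ t₁ v τ σ u c ∨ P.claims t₀ t₁ w σ u c} =
      (Set.Icc 0 1 ∩ {σ | P.blockers t₀ t₁ v τ σ u c}) ∪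
        (Set.Icc 0 1 ∩ {σ | P.claims t₀ t₁ w σ u c}) := by
    rw [← Set.inter_union_distrib_left]
    rfl
  rw [hset]
  refine measureReal_union ?_ (measurableSet_Icc.inter (measurableSet_claims t₀ t₁ w u c))
    (measure_ne_top_of_subset Set.inter_subset_left (by simp))
    (measure_ne_top_of_subset Set.inter_subset_left (by simp))
  rw [Set.disjoint_left]
  rintro σ ⟨-, -, ⟨h1, -⟩ | ⟨h1, -⟩⟩ ⟨-, h2, h3, -⟩
  · exact hw (h3.symm.trans h1)
  · exact absurd h2 (not_le.2 h1)

theorem le_law_avoids_blockers {τ : ℝ} (hτ : 0 ≤ τ) (v : P.Offline) :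
    ENNReal.ofReal (Real.exp (-blockingBound t₀ t₁ (P.firstClassFlow v) τ)) ≤
      P.law {ω | Avoids ω (P.blockers t₀ t₁ v τ)} := by
  rw [law_avoids fun u c => measurableSet_blockers t₀ t₁ τ v u c]
  exact ENNReal.ofReal_le_ofReal (Real.exp_le_exp.2 (neg_le_neg (intensity_blockers_le hτ)))

theorem le_law_avoids_blockers_not_claims (h0 : 0 ≤ t₀) (h₀₁ : t₀ ≤ t₁) (h1 : t₁ ≤ 1) {τ : ℝ}
    (hτ : 0 ≤ τ) {v w : P.Offline} (hw : w ≠ v) :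
    ENNReal.ofReal (Real.exp (-blockingBound t₀ t₁ (P.firstClassFlow v) τ) *
        (1 - Real.exp (-(t₁ - t₀)))) ≤
      P.law {ω | Avoids ω (P.blockers t₀ t₁ v τ) ∧ ¬ Avoids ω (P.claims t₀ t₁ w)} := by
  have hset : {ω : P.Sample | Avoids ω (P.blockers t₀ t₁ v τ) ∧
      ¬ Avoids ω (P.claims t₀ t₁ w)} = {ω | Avoids ω (P.blockers t₀ t₁ v τ)} \
      {ω | Avoids ω fun σ u c => P.blockers t₀ t₁ v τ σ u c ∨ P.claims t₀ t₁ w σ u c} := by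
    ext ω
    constructor
    · rintro ⟨h2, h3⟩
      exact ⟨h2, fun h4 => h3 fun s k hk => h4 s k (Or.inr hk)⟩
    · rintro ⟨h2, h3⟩
      refine ⟨h2, fun h4 => h3 fun s k hk => ?_⟩
      rcases hk with hk | hk
      · exact h2 s k hk
      · exact h4 s k hk
  rw [hset]
  refine le_trans ?_ le_measure_sdiff
  have hor : ∀ u c,
      MeasurableSet {σ | P.blockers t₀ t₁ v τ σ u c ∨ P.claims t₀ t₁ w σ u c} := fun u c =>
    (measurableSet_blockers t₀ t₁ τ v u c).union (measurableSet_claims t₀ t₁ w u c)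
  rw [law_avoids fun u c => measurableSet_blockers t₀ t₁ τ v u c, law_avoids hor,
    ← ENNReal.ofReal_sub _ (Real.exp_pos _).le,
    intensity_blockers_or_claims hw]
  refine ENNReal.ofReal_le_ofReal ?_
  rw [neg_add, Real.exp_add, ← mul_one_sub]
  have h2 := le_intensity_claims h0 h₀₁ h1 w
  refine mul_le_mul (Real.exp_le_exp.2 (neg_le_neg (intensity_blockers_le hτ))) ?_ ?_
    (Real.exp_pos _).le
  · exact sub_le_sub_left (Real.exp_le_exp.2 (neg_le_neg h2)) _
  · rw [sub_nonneg, Real.exp_le_one_iff]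
    linarith

open Classical in
/-- A lower bound for the probability that an arrival of type `u` with coin `c` at the time `τ` is
matched to `v`. -/
def successBound (P : G.Preprocessed x) (t₀ t₁ : ℝ) (u : Fin P.numTypes) (v : P.Offline) (τ : ℝ)
    (c : P.Offline) : ℝ≥0∞ :=
  if c = v then
    if 0 ≤ τ ∧ P.Active t₀ τ u then
      ENNReal.ofReal (Real.exp (-blockingBound t₀ t₁ (P.firstClassFlow v) τ)) else 0
  else
    if 0 ≤ τ ∧ ¬ P.FirstClass u ∧ t₁ < τ then
      ENNReal.ofReal (Real.exp (-blockingBound t₀ t₁ (P.firstClassFlow v) τ) *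
        (1 - Real.exp (-(t₁ - t₀)))) else 0

theorem measurable_exp_neg_blockingBound (t₀ t₁ y : ℝ) :
    Measurable fun τ => Real.exp (-blockingBound t₀ t₁ y τ) := by
  unfold blockingBound
  fun_prop

theorem measurable_successBound (t₀ t₁ : ℝ) (u : Fin P.numTypes) (v c : P.Offline) :
    Measurable fun τ => P.successBound t₀ t₁ u v τ c := by
  classical
  unfold successBound Active
  split_ifs
  · refine Measurable.ite ?_ (measurable_exp_neg_blockingBound _ _ _).ennreal_ofReal
      measurable_const
    exact measurableSet_Ici.inter (MeasurableSet.union (.const _) measurableSet_Ioi)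
  · refine Measurable.ite ?_
      ((measurable_exp_neg_blockingBound _ _ _).mul_const _).ennreal_ofReal measurable_const
    exact measurableSet_Ici.inter (MeasurableSet.inter (.const _) measurableSet_Ioi)

theorem successBound_le (h0 : 0 ≤ t₀) (h₀₁ : t₀ ≤ t₁) (h1 : t₁ ≤ 1) {s : Option I}
    {p : ℝ × P.Mark s} (hp : p.2.typ = u) :
    P.successBound t₀ t₁ u v p.1 p.2.coin ≤ P.law {ω | Succeeds t₀ t₁ u v p ω} := by
  unfold successBound
  split_ifs with hc h h
  · refine (le_law_avoids_blockers h.1 v).trans (measure_mono fun ω hω => ?_)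
    exact ⟨hp, hω, Or.inl ⟨hc, h.2⟩⟩
  · exact zero_le
  · refine (le_law_avoids_blockers_not_claims h0 h₀₁ h1 h.1 hc).trans
      (measure_mono fun ω hω => ?_)
    exact ⟨hp, hω.1, Or.inr ⟨hc, h.2.1, h.2.2, hω.2⟩⟩
  · exact zero_le

theorem sum_lintegral_successBound_le (h0 : 0 ≤ t₀) (h₀₁ : t₀ ≤ t₁) (h1 : t₁ ≤ 1)
    (hv : v ∈ P.neighbors u) :
    ∑ c, ENNReal.ofReal (P.flow u c) * ∫⁻ τ in Set.Icc 0 1, P.successBound t₀ t₁ u v τ c ≤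
      P.law {ω | EdgeMatched t₀ t₁ u v ω} := by
  classical
  refine le_trans ?_ (lintegral_succeeds_le h₀₁ hv (P.orig u))
  have h := lintegral_pointLaw_markLaw (P := P) (P.orig u)
    (F := fun τ u' c => if u' = u then P.successBound t₀ t₁ u v τ c else 0) fun u' c => by
      split_ifs
      · exact measurable_successBound t₀ t₁ u v c
      · exact measurable_const
  have h2 : ∑ c, ENNReal.ofReal (P.flow u c) *
      ∫⁻ τ in Set.Icc 0 1, P.successBound t₀ t₁ u v τ c ≤
      ∑ u' with P.orig u' = P.orig u, ∑ c, ENNReal.ofReal (P.flow u' c) *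
        ∫⁻ τ in Set.Icc 0 1, if u' = u then P.successBound t₀ t₁ u v τ c else 0 := by
    refine le_trans (le_of_eq ?_) (Finset.single_le_sum
      (f := fun u' => ∑ c, ENNReal.ofReal (P.flow u' c) *
        ∫⁻ τ in Set.Icc 0 1, if u' = u then P.successBound t₀ t₁ u v τ c else 0)
      (fun _ _ => zero_le) (Finset.mem_filter.2 ⟨Finset.mem_univ u, rfl⟩))
    simp
  refine h2.trans (h.symm.le.trans ?_)
  gcongr with p
  split_ifs with hp
  · exact successBound_le h0 h₀₁ h1 hp
  · exact zero_le

theorem lintegral_Ioc_ofReal {f : ℝ → ℝ} (hf : Continuous f) (hf0 : ∀ τ, 0 ≤ f τ) {a b : ℝ}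
    (hab : a ≤ b) :
    ∫⁻ τ in Set.Ioc a b, ENNReal.ofReal (f τ) = ENNReal.ofReal (∫ τ in a..b, f τ) := by
  rw [intervalIntegral.integral_of_le hab, ofReal_integral_eq_lintegral_ofReal
    (hf.integrableOn_Ioc) (Filter.Eventually.of_forall hf0)]

theorem continuous_exp_neg_blockingBound (t₀ t₁ y : ℝ) :
    Continuous fun τ => Real.exp (-blockingBound t₀ t₁ y τ) := by
  unfold blockingBound
  fun_prop

theorem le_lintegral_of_Ioc {f g : ℝ → ℝ≥0∞} {a : ℝ} (ha : 0 ≤ a)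
    (h : ∀ τ, a < τ → f τ ≤ g τ) :
    ∫⁻ τ in Set.Ioc a 1, f τ ≤ ∫⁻ τ in Set.Icc 0 1, g τ :=
  (setLIntegral_mono' measurableSet_Ioc fun τ hτ => h τ hτ.1).trans
    (lintegral_mono_set fun _ hτ => ⟨ha.trans hτ.1.le, hτ.2⟩)

theorem flow_mul_integral_le_of_firstClass (h0 : 0 ≤ t₀) (h₀₁ : t₀ ≤ t₁) (h1 : t₁ ≤ 1)
    (hv : v ∈ P.neighbors u) (hu : P.FirstClass u) :
    P.flow u v * ∫ τ in (0 : ℝ)..1, Real.exp (-blockingBound t₀ t₁ (P.firstClassFlow v) τ) ≤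
      P.law.real {ω | EdgeMatched t₀ t₁ u v ω} := by
  refine (ENNReal.ofReal_le_iff_le_toReal (measure_ne_top _ _)).1 ?_
  refine le_trans ?_ (sum_lintegral_successBound_le h0 h₀₁ h1 hv)
  refine le_trans ?_ (Finset.single_le_sum (fun _ _ => zero_le) (Finset.mem_univ v))
  rw [ENNReal.ofReal_mul (P.flow_nonneg u v), ← lintegral_Ioc_ofReal
    (continuous_exp_neg_blockingBound _ _ _) (fun τ => (Real.exp_pos _).le) zero_le_one]
  refine mul_le_mul_right (le_lintegral_of_Ioc le_rfl fun τ hτ => ?_) _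
  rw [successBound, if_pos rfl, if_pos ⟨hτ.le, Or.inl hu⟩]

theorem flow_mul_integral_le_of_not_firstClass (h0 : 0 ≤ t₀) (h₀₁ : t₀ ≤ t₁) (h1 : t₁ ≤ 1)
    (hv : v ∈ P.neighbors u) (hu : ¬ P.FirstClass u) :
    P.flow u v *
        ((∫ τ in t₀..1, Real.exp (-blockingBound t₀ t₁ (P.firstClassFlow v) τ)) +
          (∫ τ in t₁..1, Real.exp (-blockingBound t₀ t₁ (P.firstClassFlow v) τ)) *
            (1 - Real.exp (-(t₁ - t₀)))) ≤
      P.law.real {ω | EdgeMatched t₀ t₁ u v ω} := by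
  classical
  have hE : 0 ≤ 1 - Real.exp (-(t₁ - t₀)) := by
    rw [sub_nonneg, Real.exp_le_one_iff]
    linarith
  have hint : ∀ a ≤ (1 : ℝ),
      0 ≤ ∫ τ in a..1, Real.exp (-blockingBound t₀ t₁ (P.firstClassFlow v) τ) := fun a ha =>
    intervalIntegral.integral_nonneg ha fun τ _ => (Real.exp_pos _).le
  have hcont : Continuous fun τ => Real.exp (-blockingBound t₀ t₁ (P.firstClassFlow v) τ) *
      (1 - Real.exp (-(t₁ - t₀))) :=
    (continuous_exp_neg_blockingBound _ _ _).mul continuous_const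
  obtain ⟨v', hne, hflow, -⟩ := exists_other_neighbor hu hv
  refine (ENNReal.ofReal_le_iff_le_toReal (measure_ne_top _ _)).1 ?_
  refine le_trans ?_ (sum_lintegral_successBound_le h0 h₀₁ h1 hv)
  refine le_trans ?_ (Finset.sum_le_sum_of_subset (Finset.subset_univ {v, v'}))
  rw [Finset.sum_pair hne.symm, hflow, ← mul_add, ENNReal.ofReal_mul (P.flow_nonneg u v),
    ENNReal.ofReal_add (hint _ (h₀₁.trans h1)) (mul_nonneg (hint _ h1) hE),
    ← intervalIntegral.integral_mul_const, ← lintegral_Ioc_ofReal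
      (continuous_exp_neg_blockingBound _ _ _) (fun τ => (Real.exp_pos _).le) (h₀₁.trans h1),
    ← lintegral_Ioc_ofReal hcont (fun τ => mul_nonneg (Real.exp_pos _).le hE) h1]
  refine mul_le_mul_right (add_le_add ?_ ?_) _
  · refine le_lintegral_of_Ioc h0 fun τ hτ => ?_
    rw [successBound, if_pos rfl, if_pos ⟨(h0.trans hτ.le), Or.inr hτ⟩]
  · refine le_lintegral_of_Ioc (h0.trans h₀₁) fun τ hτ => ?_
    rw [successBound, if_neg hne, if_pos ⟨((h0.trans h₀₁).trans hτ.le), hu, hτ⟩]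

end Preprocessed

end StochInstance

/-! ### Numerical bounds -/

theorem exp_neg_seven_tenths_lt : Real.exp (-0.7) < 0.496586 := by
  have h := Real.exp_bound (x := -0.7) (by norm_num [abs_le]) (n := 9) (by norm_num)
  have := (abs_le.1 h).2
  norm_num [Finset.sum_range_succ, Nat.factorial] at this
  norm_num
  linarith

theorem lt_exp_neg_seven_tenths : 0.496585 < Real.exp (-0.7) := by
  have h := Real.exp_bound (x := -0.7) (by norm_num [abs_le]) (n := 9) (by norm_num)
  have := (abs_le.1 h).1
  norm_num [Finset.sum_range_succ, Nat.factorial] at this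
  norm_num
  linarith

theorem one_sub_add_sq_le_exp_neg {x : ℝ} (h0 : 0 ≤ x) (h1 : x ≤ 0.02) :
    1 - x + 0.49 * x ^ 2 ≤ Real.exp (-x) := by
  have h := Real.exp_bound (x := -x) (by rw [abs_neg, abs_of_nonneg h0]; linarith) (n := 3)
    (by norm_num)
  have := (abs_le.1 h).1
  norm_num [Finset.sum_range_succ, Nat.factorial, abs_of_nonneg h0] at this
  norm_num
  nlinarith [mul_nonneg (sq_nonneg x) (sub_nonneg.2 h1)]

theorem polynomial_le_one_sub_exp_neg {x : ℝ} (h0 : 0 ≤ x) (h1 : x ≤ 1) :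
    x - x ^ 2 / 2 + x ^ 3 / 6 - x ^ 4 / 24 + x ^ 5 / 120 - 7 * x ^ 6 / 4320 ≤
      1 - Real.exp (-x) := by
  have h := Real.exp_bound (x := -x) (by rw [abs_neg, abs_of_nonneg h0]; linarith) (n := 6)
    (by norm_num)
  have := (abs_le.1 h).2
  norm_num [Finset.sum_range_succ, Nat.factorial, abs_of_nonneg h0] at this
  ring_nf at this ⊢
  linarith

/-- A linear function that lies slightly below the tangent at `y = 1 - log 2` of the convex function
`(1 - exp (-(2 - y) / 4)) / (2 - y)`. -/
theorem linear_le_one_sub_exp_div {y : ℝ} (h0 : 0 ≤ y) (h1 : y ≤ 0.30685282) :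
    0.20382 + 0.02368 * (y - 0.30685282) ≤ (1 - Real.exp (-((2 - y) / 4))) / (2 - y) := by
  obtain ⟨z, rfl⟩ : ∃ z, y = 0.30685282 - z := ⟨0.30685282 - y, by ring⟩
  have hz : 0 ≤ z := by linarith
  have hz1 : z ≤ 0.31 := by linarith
  rw [le_div_iff₀ (by linarith)]
  have h := polynomial_le_one_sub_exp_neg (x := (2 - (0.30685282 - z)) / 4) (by linarith)
    (by linarith)
  refine le_trans ?_ h
  have hb : 0 < 2 - (0.30685282 - z) := by linarith
  have key : 0 ≤ 1/4 - (2 - (0.30685282 - z))/32 + (2 - (0.30685282 - z))^2/384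
      - (2 - (0.30685282 - z))^3/6144 + (2 - (0.30685282 - z))^4/122880
      - (2 - (0.30685282 - z))^5*7/(4320*4096)
      - (0.20382 + 0.02368 * (0.30685282 - z - 0.30685282)) := by
    have h2 : 0 ≤ z ^ 2 := by positivity
    have h3 : z ^ 3 ≤ 0.31 * z ^ 2 := by nlinarith
    have h3' : 0 ≤ z ^ 3 := by positivity
    have h4 : 0 ≤ z ^ 4 := by positivity
    have h5 : z ^ 5 ≤ 0.31 * z ^ 4 := by nlinarith
    ring_nf
    nlinarith [sq_nonneg (z - 0.01)]
  nlinarith [mul_nonneg hb.le key]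

namespace StochInstance.Preprocessed

theorem integral_exp_neg_add_mul (c b d a₁ a₂ : ℝ) (hb : b ≠ 0) :
    ∫ τ in a₁..a₂, Real.exp (-(c + b * (τ - d))) =
      (Real.exp (-(c + b * (a₁ - d))) - Real.exp (-(c + b * (a₂ - d)))) / b := by
  have h : ∀ τ, HasDerivAt (fun τ => -Real.exp (-(c + b * (τ - d))) / b)
      (Real.exp (-(c + b * (τ - d)))) τ := by
    intro τ
    have h1 : HasDerivAt (fun τ => -(c + b * (τ - d))) (-(b * 1)) τ :=
      ((((hasDerivAt_id τ).sub_const d).const_mul b).const_add c).neg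
    refine (h1.exp.neg.div_const b).congr_deriv ?_
    field_simp
  rw [intervalIntegral.integral_eq_sub_of_hasDerivAt (fun τ _ => h τ)
    (Continuous.intervalIntegrable (by fun_prop) _ _)]
  ring

variable {y : ℝ}

theorem integral_first_stage :
    0.05 - y / 800 ≤ ∫ τ in (0 : ℝ)..0.05, Real.exp (-blockingBound 0.05 0.75 y τ) := by
  have h : ∫ τ in (0 : ℝ)..0.05, (1 - y * τ) = 0.05 - y / 800 := by
    rw [intervalIntegral.integral_sub (by simp)
      (Continuous.intervalIntegrable (by fun_prop) _ _), intervalIntegral.integral_const_mul,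
      integral_id]
    simp
    ring
  rw [← h]
  refine intervalIntegral.integral_mono_on (by norm_num)
    (Continuous.intervalIntegrable (by fun_prop) _ _)
    ((continuous_exp_neg_blockingBound _ _ _).intervalIntegrable _ _) fun τ hτ => ?_
  have hb : blockingBound 0.05 0.75 y τ = y * τ := by
    rw [blockingBound, max_eq_right (by linarith [hτ.2]), max_eq_right (by linarith [hτ.2])]
    ring
  rw [hb]
  linarith [Real.add_one_le_exp (-(y * τ))]

theorem integral_second_stage :
    ∫ τ in (0.05 : ℝ)..0.75, Real.exp (-blockingBound 0.05 0.75 y τ) =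
      Real.exp (-(y / 20)) * (1 - Real.exp (-0.7)) := by
  have h : ∫ τ in (0.05 : ℝ)..0.75, Real.exp (-blockingBound 0.05 0.75 y τ) =
      ∫ τ in (0.05 : ℝ)..0.75, Real.exp (-(y / 20 + 1 * (τ - 0.05))) := by
    refine intervalIntegral.integral_congr fun τ hτ => ?_
    rw [Set.uIcc_of_le (by norm_num)] at hτ
    simp only [blockingBound]
    rw [max_eq_left (by linarith [hτ.1]), max_eq_right (by linarith [hτ.2])]
    congr 1
    ring
  rw [h, integral_exp_neg_add_mul _ _ _ _ _ one_ne_zero, mul_one_sub, ← Real.exp_add]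
  norm_num
  ring_nf

theorem integral_third_stage (h2 : y < 2) :
    ∫ τ in (0.75 : ℝ)..1, Real.exp (-blockingBound 0.05 0.75 y τ) =
      Real.exp (-(y / 20)) * Real.exp (-0.7) *
        ((1 - Real.exp (-((2 - y) / 4))) / (2 - y)) := by
  have h : ∫ τ in (0.75 : ℝ)..1, Real.exp (-blockingBound 0.05 0.75 y τ) =
      ∫ τ in (0.75 : ℝ)..1, Real.exp (-(y / 20 + 0.7 + (2 - y) * (τ - 0.75))) := by
    refine intervalIntegral.integral_congr fun τ hτ => ?_
    rw [Set.uIcc_of_le (by norm_num)] at hτ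
    simp only [blockingBound]
    rw [max_eq_left (by linarith [hτ.1]), max_eq_left (by linarith [hτ.1])]
    congr 1
    ring
  rw [h, integral_exp_neg_add_mul _ _ _ _ _ (by linarith), mul_div_assoc',
    mul_one_sub (Real.exp _ * Real.exp _), ← Real.exp_add, ← Real.exp_add]
  congr 3 <;> ring_nf

/-- The competitive ratio of the edges of first-class types. The worst case is `y = 1 - log 2`, where
the integral is about `0.64504`; the constants in the proof lose less than `10⁻⁵`. -/
theorem bound_of_firstClass (h0 : 0 ≤ y) (h1 : y ≤ 1 - Real.log 2) :
    0.645 ≤ ∫ τ in (0 : ℝ)..1, Real.exp (-blockingBound 0.05 0.75 y τ) := by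
  have hlog := Real.log_two_gt_d9
  have hy : y ≤ 0.30685282 := by linarith
  have hint : ∀ a b, IntervalIntegrable
      (fun τ => Real.exp (-blockingBound 0.05 0.75 y τ)) volume a b := fun a b =>
    (continuous_exp_neg_blockingBound _ _ _).intervalIntegrable a b
  rw [← intervalIntegral.integral_add_adjacent_intervals (hint 0 0.05) (hint 0.05 1),
    ← intervalIntegral.integral_add_adjacent_intervals (hint 0.05 0.75) (hint 0.75 1),
    integral_second_stage, integral_third_stage (by linarith)]
  have hfirst := integral_first_stage (y := y)
  have hW := linear_le_one_sub_exp_div h0 hy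
  have hq := one_sub_add_sq_le_exp_neg (x := y / 20) (by linarith) (by linarith)
  have hE := exp_neg_seven_tenths_lt
  set E := Real.exp (-0.7)
  set q := Real.exp (-(y / 20))
  set W := (1 - Real.exp (-((2 - y) / 4))) / (2 - y)
  have hE0 : 0 < E := Real.exp_pos _
  have hq0 : 0 < q := Real.exp_pos _
  have h2 : 1 - 0.496586 * (1 - (0.20382 + 0.02368 * (y - 0.30685282))) ≤ 1 - E + E * W := by
    nlinarith
  have h3 : (1 - y / 20 + 0.49 * (y / 20) ^ 2) *
      (1 - 0.496586 * (1 - (0.20382 + 0.02368 * (y - 0.30685282)))) ≤ q * (1 - E + E * W) :=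
    mul_le_mul hq h2 (by nlinarith) hq0.le
  nlinarith [mul_nonneg h0 (sub_nonneg.2 hy), mul_nonneg (sq_nonneg y) (sub_nonneg.2 hy)]

/-- The competitive ratio of the edges of second-class types. The second summand stands for the
arrivals after `t₁` whose coin is the other neighbor. -/
theorem bound_of_not_firstClass (h0 : 0 ≤ y) (h1 : y ≤ 1 - Real.log 2) :
    0.645 ≤ (∫ τ in (0.05 : ℝ)..1, Real.exp (-blockingBound 0.05 0.75 y τ)) +
      (∫ τ in (0.75 : ℝ)..1, Real.exp (-blockingBound 0.05 0.75 y τ)) *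
        (1 - Real.exp (-(0.75 - 0.05))) := by
  have hlog := Real.log_two_gt_d9
  have hy : y ≤ 0.30685282 := by linarith
  have hint : ∀ a b, IntervalIntegrable
      (fun τ => Real.exp (-blockingBound 0.05 0.75 y τ)) volume a b := fun a b =>
    (continuous_exp_neg_blockingBound _ _ _).intervalIntegrable a b
  rw [← intervalIntegral.integral_add_adjacent_intervals (hint 0.05 0.75) (hint 0.75 1),
    integral_second_stage, integral_third_stage (by linarith),
    show (0.75 : ℝ) - 0.05 = 0.7 by norm_num]
  have hW := linear_le_one_sub_exp_div h0 hy
  have hq := one_sub_add_sq_le_exp_neg (x := y / 20) (by linarith) (by linarith)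
  have hE := exp_neg_seven_tenths_lt
  have hE' := lt_exp_neg_seven_tenths
  set E := Real.exp (-0.7)
  set q := Real.exp (-(y / 20))
  set W := (1 - Real.exp (-((2 - y) / 4))) / (2 - y)
  have hq0 : 0 < q := Real.exp_pos _
  have hE2 : 0.496585 * 1.503414 ≤ E * (2 - E) := by nlinarith
  have hW0 : 0 ≤ 0.20382 + 0.02368 * (y - 0.30685282) := by linarith
  have h2 : 0.503414 + 0.496585 * 1.503414 * (0.20382 + 0.02368 * (y - 0.30685282)) ≤
      1 - E + E * (2 - E) * W := by
    have := mul_le_mul hE2 hW hW0 (by nlinarith)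
    linarith
  have h3 : (1 - y / 20 + 0.49 * (y / 20) ^ 2) *
      (0.503414 + 0.496585 * 1.503414 * (0.20382 + 0.02368 * (y - 0.30685282))) ≤
      q * (1 - E + E * (2 - E) * W) :=
    mul_le_mul hq h2 (by linarith) hq0.le
  nlinarith [mul_nonneg h0 (sub_nonneg.2 hy), mul_nonneg (sq_nonneg y) (sub_nonneg.2 hy)]

end StochInstance.Preprocessed

namespace StochInstance

namespace Preprocessed

variable {I J : Type*} [Fintype I] [Fintype J] {G : StochInstance I J} {x : I → J → ℝ}
  {P : G.Preprocessed x}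

/-! ### The competitive ratio -/

/-- Every edge is matched with at least `0.645` times the probability that its flow suggests. -/
theorem flow_le_law_edgeMatched (u : Fin P.numTypes) (v : P.Offline) :
    0.645 * P.flow u v ≤ P.law.real {ω | EdgeMatched 0.05 0.75 u v ω} := by
  by_cases hv : v ∈ P.neighbors u
  · rw [mul_comm]
    by_cases hu : P.FirstClass u
    · refine le_trans ?_ (flow_mul_integral_le_of_firstClass (by norm_num) (by norm_num)
        (by norm_num) hv hu)
      exact mul_le_mul_of_nonneg_left
        (bound_of_firstClass (firstClassFlow_nonneg v) (firstClassFlow_le v)) (P.flow_nonneg u v)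
    · refine le_trans ?_ (flow_mul_integral_le_of_not_firstClass (by norm_num) (by norm_num)
        (by norm_num) hv hu)
      exact mul_le_mul_of_nonneg_left
        (bound_of_not_firstClass (firstClassFlow_nonneg v) (firstClassFlow_le v))
        (P.flow_nonneg u v)
  · rw [Preprocessed.flow_eq_zero hv, mul_zero]
    exact measureReal_nonneg

theorem mem_neighbors_of_edgeMatched {t₀ t₁ : ℝ} {u : Fin P.numTypes} {v : P.Offline}
    {ω : P.Sample} (h : EdgeMatched t₀ t₁ u v ω) : v ∈ P.neighbors u := by
  obtain ⟨a, ha, rfl⟩ := h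
  exact mem_neighbors_of_output ha

/-- The weight of the edge between the split type `u` and `j`; it is `0` for dummy types. -/
def splitWeight (P : G.Preprocessed x) (u : Fin P.numTypes) (j : J) : ℝ :=
  (P.orig u).elim 0 fun i => G.weight i j

open Classical in
theorem algValue_eq_sum (t₀ t₁ : ℝ) (ω : P.Sample) : algValue t₀ t₁ ω = ∑ j, ∑ u,
    P.splitWeight u j * {ω | EdgeMatched t₀ t₁ u (Sum.inl j) ω}.indicator 1 ω := by
  refine Finset.sum_congr rfl fun j _ => ?_
  cases h : output t₀ t₁ ω (Sum.inl j) with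
  | none =>
    refine (Finset.sum_eq_zero fun u _ => ?_).symm
    rw [Set.indicator_of_notMem, mul_zero]
    rintro ⟨a, ha, -⟩
    rw [h] at ha
    cases ha
  | some a =>
    rw [Finset.sum_eq_single (mark ω a).typ]
    · rw [Set.indicator_of_mem (by exact ⟨a, h, rfl⟩), Pi.one_apply, mul_one, splitWeight,
        (mark ω a).orig_typ]
      obtain ⟨_ | i, k⟩ := a <;> rfl
    · intro u _ hu
      rw [Set.indicator_of_notMem, mul_zero]
      rintro ⟨b, hb, rfl⟩
      rw [h] at hb
      cases hb
      exact hu rfl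
    · simp

theorem integrable_indicator_edgeMatched (t₀ t₁ : ℝ) (u : Fin P.numTypes) (v : P.Offline) :
    Integrable ({ω | EdgeMatched t₀ t₁ u v ω}.indicator (1 : P.Sample → ℝ)) P.law :=
  (integrable_const (1 : ℝ)).indicator (measurableSet_edgeMatched t₀ t₁ u v)

theorem integrable_algValue (t₀ t₁ : ℝ) : Integrable (algValue (P := P) t₀ t₁) P.law := by
  rw [funext (algValue_eq_sum t₀ t₁)]
  exact integrable_finsetSum _ fun j _ => integrable_finsetSum _ fun u _ =>
    (integrable_indicator_edgeMatched t₀ t₁ u (Sum.inl j)).const_mul _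

theorem integral_algValue (t₀ t₁ : ℝ) : ∫ ω, algValue t₀ t₁ ω ∂P.law = ∑ j, ∑ u,
    P.splitWeight u j * P.law.real {ω | EdgeMatched t₀ t₁ u (Sum.inl j) ω} := by
  simp_rw [algValue_eq_sum]
  rw [integral_finsetSum _ fun j _ => integrable_finsetSum _ fun u _ =>
    (integrable_indicator_edgeMatched t₀ t₁ u (Sum.inl j)).const_mul _]
  refine Finset.sum_congr rfl fun j _ => ?_
  rw [integral_finsetSum _ fun u _ =>
    (integrable_indicator_edgeMatched t₀ t₁ u (Sum.inl j)).const_mul _]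
  refine Finset.sum_congr rfl fun u _ => ?_
  rw [integral_const_mul, integral_indicator_one (measurableSet_edgeMatched t₀ t₁ u _)]

theorem sum_splitWeight_mul_flow (j : J) :
    ∑ u, P.splitWeight u j * P.flow u (Sum.inl j) = ∑ i, G.weight i j * x i j := by
  classical
  rw [← Finset.sum_fiberwise Finset.univ P.orig, Fintype.sum_option]
  have h0 : ∑ u with P.orig u = none, P.splitWeight u j * P.flow u (Sum.inl j) = 0 :=
    Finset.sum_eq_zero fun u hu => by
      rw [splitWeight, (Finset.mem_filter.1 hu).2, Option.elim_none, zero_mul]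
  rw [h0, zero_add]
  refine Finset.sum_congr rfl fun i _ => ?_
  rw [← P.split_flow i j, Finset.mul_sum]
  refine Finset.sum_congr (by congr) fun u hu => ?_
  rw [splitWeight, (Finset.mem_filter.1 hu).2, Option.elim_some]

/-- A split type has no flow to the offline vertices to which its original type is not adjacent. -/
theorem flow_eq_zero_of_not_adj (hx : G.IsFeasible x) {u : Fin P.numTypes} {i : I}
    (hu : P.orig u = some i) {j : J} (hij : ¬ G.Adj i j) : P.flow u (Sum.inl j) = 0 := by
  classical
  have h := P.split_flow i j
  rw [hx.support i j hij, Finset.sum_eq_zero_iff_of_nonneg fun u _ => P.flow_nonneg u _] at h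
  exact h u (Finset.mem_filter.2 ⟨Finset.mem_univ u, hu⟩)

theorem objective_le_integral_algValue (hx : G.IsFeasible x) :
    0.645 * G.objective x ≤ ∫ ω, algValue (P := P) 0.05 0.75 ω ∂P.law := by
  rw [integral_algValue, objective, Finset.sum_comm, Finset.mul_sum]
  refine Finset.sum_le_sum fun j _ => ?_
  rw [← sum_splitWeight_mul_flow (P := P), Finset.mul_sum]
  refine Finset.sum_le_sum fun u _ => ?_
  rw [mul_left_comm]
  by_cases hv : Sum.inl j ∈ P.neighbors u
  · refine mul_le_mul_of_nonneg_left (flow_le_law_edgeMatched u (Sum.inl j)) ?_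
    rw [splitWeight]
    cases hu : P.orig u with
    | none => exact le_rfl
    | some i =>
      refine G.weight_nonneg i j ?_
      by_contra hij
      exact (mem_neighbors.1 hv).ne' (flow_eq_zero_of_not_adj hx hu hij)
  -- weights of pairs that are not adjacent may be negative, but these pairs are never matched
  · have hempty : {ω : P.Sample | EdgeMatched 0.05 0.75 u (Sum.inl j) ω} = ∅ :=
      Set.eq_empty_of_forall_notMem fun ω hω => hv (mem_neighbors_of_edgeMatched hω)
    rw [Preprocessed.flow_eq_zero hv, hempty]
    simp

end Preprocessed

end StochInstance

end OnlineMatching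

end

theorem theorem2 {I J : Type*} [Fintype I] [Fintype J]
    (G : OnlineMatching.StochInstance I J) :
    (∃ x, G.IsOptimal x) ∧
    ∀ x, G.IsFeasible x →
      Nonempty (G.Preprocessed x) ∧
      ∀ P : G.Preprocessed x,
        (∀ u v, 0.645 * P.flow u v ≤
          P.law.real {ω | OnlineMatching.StochInstance.Preprocessed.EdgeMatched 0.05 0.75 u v ω}) ∧
        (G.IsOptimal x →
          MeasureTheory.Integrable G.offlineOpt G.arrivalLaw ∧
          MeasureTheory.Integrable
            (OnlineMatching.StochInstance.Preprocessed.algValue (P := P) 0.05 0.75) P.law ∧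
          0.645 * ∫ ω, G.offlineOpt ω ∂G.arrivalLaw ≤
            ∫ ω, OnlineMatching.StochInstance.Preprocessed.algValue (P := P) 0.05 0.75 ω
              ∂P.law) := by
  refine ⟨G.exists_isOptimal, fun x hx =>
    ⟨OnlineMatching.StochInstance.nonempty_preprocessed hx, fun P => ⟨fun u v =>
      OnlineMatching.StochInstance.Preprocessed.flow_le_law_edgeMatched u v, fun hopt =>
      ⟨G.integrable_offlineOpt,
        OnlineMatching.StochInstance.Preprocessed.integrable_algValue 0.05 0.75, ?_⟩⟩⟩⟩
  exact (mul_le_mul_of_nonneg_left (G.integral_offlineOpt_le hopt) (by norm_num)).trans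
    (OnlineMatching.StochInstance.Preprocessed.objective_le_integral_algValue hx)
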